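/- Let $\mathbb{K}$ be a field of characteristic zero, and let $n\ge 1$, $N\ge 1$. Let $\bar{\mathrm U}(n)$ be the localization of $\mathbb{K}[\tilde h_1,\dots,\tilde h_n]$ at the multiplicative set generated by the elements $\tilde h_i-\tilde h_j+k$, $i\ne j$, $k\in\mathbb{Z}$; write $\tilde h_{ij}=\tilde h_i-\tilde h_j$. Let $\hat{\mathrm R}^{ij}_{kl}\in\bar{\mathrm U}(n)$ be the array with $\hat{\mathrm R}^{ij}_{ij}=1/\tilde h_{ij}$ for $i\ne j$, $\hat{\mathrm R}^{ij}_{ji}=(\tilde h_{ij}^2-1)/\tilde h_{ij}^2$ for $i<j$, $\hat{\mathrm R}^{ij}_{ji}=1$ for $i\ge j$, and all other components zero. Let $\mathrm{Diff}_{\mathbf h}(n,N)$ be the $\mathbb{K}$-algebra generated over $\bar{\mathrm U}(n)$ by $x^{i\alpha},\bar\partial_{i\alpha}$ ($1\le i\le n$, $1\le\alpha\le N$) with the defining relations $$\tilde h_i x^{j\alpha}=x^{j\alpha}(\tilde h_i+\delta_i^j),\qquad \tilde h_i\bar\partial_{j\alpha}=\bar\partial_{j\alpha}(\tilde h_i-\delta_i^j),$$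 $$x^{i\alpha}x^{j\beta}=\sum_{k,l}\hat{\mathrm R}^{ij}_{kl}\,x^{k\beta}x^{l\alpha},\qquad \bar\partial_{l\alpha}\bar\partial_{k\beta}=\sum_{i,j}\bar\partial_{j\beta}\bar\partial_{i\alpha}\hat{\mathrm R}^{ij}_{kl},$$ $$x^{i\alpha}\bar\partial_{j\beta}=\sum_{k,l}\bar\partial_{k\beta}\hat{\mathrm R}^{ki}_{lj}x^{l\alpha}-\delta^i_j\delta^\alpha_\beta .$$ A quadratic central element is a central element of filtration degree at most $2$, where $x^{i\alpha},\bar\partial_{i\alpha}$ have degree $1$ and the elements of $\bar{\mathrm U}(n)$ have degree $0$. Put $A^\alpha_\beta=\sum_i\bar\partial_{i\beta}x^{i\alpha}$ and $H_1=\tilde h_1+\dots+\tilde h_n$. **Proposition.** Let $N>1$. Up to an additive constant, every quadratic central element of $\mathrm{Diff}_{\mathbf h}(n,N)$ is proportional to $\sum_\alpha A^\alpha_\alpha-H_1$: an element $z$ of $\mathrm{Diff}_{\mathbf h}(n,N)$ is quadratic central if and only if $z=a\bigl(\sum_\alpha A^\alpha_\alpha-H_1\bigr)+b$ for some $a,b\in\mathbb{K}$.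 The space of quadratic central elements modulo the constants $\mathbb{K}$ is one-dimensional. In contrast, for $N=1$ the space of quadratic central elements of $\mathrm{Diff}_{\mathbf h}(n,1)$ modulo the constants has dimension $n$. -/

import Mathlib

noncomputable section

namespace HDiff

open MvPolynomial

/-- The multiplicative set of the polynomial ring `U(n) = K[h₁, …, hₙ]` generated by the elements
`hᵢ - hⱼ + k` with `i ≠ j` and `k` an integer. -/
def denominators (K : Type*) [Field K] (n : ℕ) : Submonoid (MvPolynomial (Fin n) K) :=
  Submonoid.closure {p | ∃ i j : Fin n, i ≠ j ∧ ∃ k : ℤ, p = X i - X j + C (k : K)}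

/-- The ring of fractions of `U(n)` with respect to `denominators K n`. -/
abbrev Ubar (K : Type*) [Field K] (n : ℕ) : Type _ :=
  Localization (denominators K n)

/-- The variable `hᵢ` (with a tilde in the literature), as an element of `Ubar K n`. -/
def h (K : Type*) [Field K] {n : ℕ} (i : Fin n) : Ubar K n :=
  algebraMap (MvPolynomial (Fin n) K) (Ubar K n) (X i)

theorem isUnit_h_sub_h (K : Type*) [Field K] {n : ℕ} {i j : Fin n} (hij : i ≠ j) :
    IsUnit (h K i - h K j) := by
  have hm : (X i - X j : MvPolynomial (Fin n) K) ∈ denominators K n :=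
    Submonoid.subset_closure ⟨i, j, hij, 0, by simp⟩
  have hu := IsLocalization.map_units (Ubar K n) (⟨_, hm⟩ : denominators K n)
  simpa [h, map_sub] using hu

/-- `Rhat K i j k l` is the component of the dynamical R-matrix of type A with upper indices
`i, j` and lower indices `k, l`. (`Ring.inverse` is only applied to units, see
`isUnit_h_sub_h`.) -/
def Rhat (K : Type*) [Field K] {n : ℕ} (i j k l : Fin n) : Ubar K n :=
  if i ≠ j ∧ k = i ∧ l = j then
    Ring.inverse (h K i - h K j)
  else if k = j ∧ l = i then
    if i < j then
      ((h K i - h K j) ^ 2 - 1) * Ring.inverse ((h K i - h K j) ^ 2)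
    else 1
  else 0

/-- Generators of the ring `Diff_h(n, N)`: the elements of `Ubar K n`, the coordinates
`x^{iα}` and the derivatives `∂_{iα}`. -/
inductive Gen (K : Type*) [Field K] (n N : ℕ) : Type _
  | coeff (f : Ubar K n) : Gen K n N
  | x (i : Fin n) (α : Fin N) : Gen K n N
  | d (i : Fin n) (α : Fin N) : Gen K n N

/-- The free algebra on the generators. -/
abbrev Free (K : Type*) [Field K] (n N : ℕ) : Type _ := FreeAlgebra K (Gen K n N)

/-- The generator `f ∈ Ubar K n` in the free algebra. -/
def fc {K : Type*} [Field K] {n N : ℕ} (f : Ubar K n) : Free K n N :=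
  FreeAlgebra.ι K (Gen.coeff f)

/-- The generator `x^{iα}` in the free algebra. -/
def fx (K : Type*) [Field K] {n N : ℕ} (i : Fin n) (α : Fin N) : Free K n N :=
  FreeAlgebra.ι K (Gen.x i α)

/-- The generator `∂_{iα}` in the free algebra. -/
def fd (K : Type*) [Field K] {n N : ℕ} (i : Fin n) (α : Fin N) : Free K n N :=
  FreeAlgebra.ι K (Gen.d i α)

/-- Defining relations of `Diff_h(n, N)`. The first three say that `Ubar K n` maps to the ring by a
homomorphism of `K`-algebras; then come the weight relations, the relations among the `x`, the
relations among the `∂` and the cross-commutation relations. -/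
inductive Rel (K : Type*) [Field K] (n N : ℕ) : Free K n N → Free K n N → Prop
  | coeff_algebraMap (c : K) :
      Rel K n N (fc (algebraMap K (Ubar K n) c)) (algebraMap K (Free K n N) c)
  | coeff_add (f g : Ubar K n) : Rel K n N (fc (f + g)) (fc f + fc g)
  | coeff_mul (f g : Ubar K n) : Rel K n N (fc (f * g)) (fc f * fc g)
  | weight_x (i j : Fin n) (α : Fin N) :
      Rel K n N (fc (h K i) * fx K j α) (fx K j α * fc (h K i + if i = j then 1 else 0))
  | weight_d (i j : Fin n) (α : Fin N) :
      Rel K n N (fc (h K i) * fd K j α) (fd K j α * fc (h K i - if i = j then 1 else 0))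
  | x_x (i j : Fin n) (α β : Fin N) :
      Rel K n N (fx K i α * fx K j β)
        (∑ k, ∑ l, fc (Rhat K i j k l) * fx K k β * fx K l α)
  | d_d (k l : Fin n) (α β : Fin N) :
      Rel K n N (fd K l α * fd K k β)
        (∑ i, ∑ j, fd K j β * fd K i α * fc (Rhat K i j k l))
  | x_d (i j : Fin n) (α β : Fin N) :
      Rel K n N (fx K i α * fd K j β)
        ((∑ k, ∑ l, fd K k β * fc (Rhat K k i l j) * fx K l α)
          - if i = j ∧ α = β then 1 else 0)

/-- The ring `Diff_h(n, N)` of `h`-deformed differential operators in `N` copies. -/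
abbrev Diff (K : Type*) [Field K] (n N : ℕ) : Type _ := RingQuot (Rel K n N)

/-- The canonical homomorphism from `Ubar K n` to `Diff_h(n, N)`. -/
def coeff (K : Type*) [Field K] (n N : ℕ) : Ubar K n →ₐ[K] Diff K n N :=
  AlgHom.ofLinearMap
    { toFun := fun f => RingQuot.mkAlgHom K (Rel K n N) (fc f)
      map_add' := fun f g => by
        rw [RingQuot.mkAlgHom_rel K (Rel.coeff_add f g), map_add]
      map_smul' := fun c f => by
        rw [Algebra.smul_def, RingQuot.mkAlgHom_rel K (Rel.coeff_mul _ f), map_mul,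
          RingQuot.mkAlgHom_rel K (Rel.coeff_algebraMap c), AlgHom.commutes, Algebra.smul_def,
          RingHom.id_apply] }
    (by
      change RingQuot.mkAlgHom K (Rel K n N) (fc 1) = 1
      rw [← map_one (algebraMap K (Ubar K n)),
        RingQuot.mkAlgHom_rel K (Rel.coeff_algebraMap 1), map_one, map_one])
    (fun f g => by
      change RingQuot.mkAlgHom K (Rel K n N) (fc (f * g)) =
        RingQuot.mkAlgHom K (Rel K n N) (fc f) * RingQuot.mkAlgHom K (Rel K n N) (fc g)
      rw [RingQuot.mkAlgHom_rel K (Rel.coeff_mul f g), map_mul])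

/-- The coordinate `x^{iα}` in `Diff_h(n, N)`. -/
def x (K : Type*) [Field K] {n N : ℕ} (i : Fin n) (α : Fin N) : Diff K n N :=
  RingQuot.mkAlgHom K (Rel K n N) (fx K i α)

/-- The derivative `∂_{iα}` in `Diff_h(n, N)`. -/
def d (K : Type*) [Field K] {n N : ℕ} (i : Fin n) (α : Fin N) : Diff K n N :=
  RingQuot.mkAlgHom K (Rel K n N) (fd K i α)

/-- The element `A^α_β = ∑ᵢ ∂_{iβ} x^{iα}`. -/
def A (K : Type*) [Field K] (n : ℕ) {N : ℕ} (α β : Fin N) : Diff K n N :=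
  ∑ i : Fin n, d K i β * x K i α

/-- The complete symmetric polynomial of degree one in the `hᵢ`. -/
def H₁ (K : Type*) [Field K] (n : ℕ) : Ubar K n := ∑ i : Fin n, h K i

/-- The elements of filtration degree at most `m`, where the `x^{iα}` and the `∂_{iα}` have degree
one and the elements of `Ubar K n` have degree zero. -/
def degLE (K : Type*) [Field K] (n N m : ℕ) : Submodule K (Diff K n N) :=
  Submodule.span K {z | ∃ (f : Ubar K n) (w : List (Diff K n N)), w.length ≤ m ∧
    (∀ y ∈ w, ∃ (i : Fin n) (α : Fin N), y = x K i α ∨ y = d K i α) ∧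
    z = coeff K n N f * w.prod}

/-- The space of quadratic central elements: the central elements of filtration degree at most
two. -/
def quadCentral (K : Type*) [Field K] (n N : ℕ) : Submodule K (Diff K n N) :=
  degLE K n N 2 ⊓ Subalgebra.toSubmodule (Subalgebra.center K (Diff K n N))

/-- The space of quadratic central elements modulo the scalars, as a subspace of
`Diff_h(n, N) / K`. -/
def quadCentralModScalars (K : Type*) [Field K] (n N : ℕ) :
    Submodule K (Diff K n N ⧸ Submodule.span K {(1 : Diff K n N)}) :=
  (quadCentral K n N).map (Submodule.span K {(1 : Diff K n N)}).mkQ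

end HDiff

end

/-! Write Δ_i for the difference operator `diffOp i`, and E_i for `euler K N i`. Every quadratic
central element has the form f - ∑ Δ_i(f) E_i with f in `Ubar K n`. Commuting with a generic linear
combination of the h_i forces weight zero, which in degree at most two leaves a coefficient plus
terms F ∂_{iγ} x^{iδ} (`quadCentral_le_weightZero`). Commuting with one derivative on a vacuum
vector then expresses every F through f (`quadCentral_eq`).

Reading off coefficients needs a module where enough vectors are independent. This is the Fock
space: the algebra of derivatives over the rational functions, on which x^{iα} kills 1 and acts by
being moved to the right. That this action exists is a Yang-Baxter type computation, split between
`vecD_vecD_single` (compatibility with the ∂∂ relations) and `exchange` (the xx relations).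

Commuting with two derivatives on the vacuum (`diffOp_relation`) equates, for k ≠ l, a multiple Δ_l
Δ_k f of ∂_{lα}∂_{kβ}1 with a multiple (Δ_l f - Δ_k f)/(h_k - h_l) of ∂_{lβ}∂_{kα}1. If N > 1, take
α ≠ β: the two vectors are independent, so all Δ_k f agree. Together with Δ_k² f = 0 this gives f =
a H₁ + b. If N = 1, the vectors coincide and what remains is Δ_k² f = 0 and (h_k - h_l) Δ_l Δ_k f =
Δ_l f - Δ_k f. The solutions are spanned by the elementary symmetric polynomials e_0, …, e_n
(`esymmSolutions_le`), which leaves dimension n modulo constants.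

The converse is a reordering computation in the algebra itself (`x_mul_euler`, `euler_mul_d`). The
correction terms telescope for f = H₁ and any N; for N = 1 they are multiples of the E_i and cancel
exactly because of the difference equations. -/

noncomputable section

namespace HDiff

open MvPolynomial

/-! ### Shifts of the coefficient ring and evaluation on a grid -/

section Ubar

variable {K : Type*} [Field K] {n : ℕ}

theorem isUnit_h_sub_h_add (i j : Fin n) (hij : i ≠ j) (k : ℤ) :
    IsUnit (h K i - h K j + (k : Ubar K n)) := by
  have hm : (X i - X j + C (k : K) : MvPolynomial (Fin n) K) ∈ denominators K n :=
    Submonoid.subset_closure ⟨i, j, hij, k, rfl⟩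
  have hu := IsLocalization.map_units (Ubar K n) (⟨_, hm⟩ : denominators K n)
  simpa [h, map_sub, map_add] using hu

/-- The homomorphism from `Ubar K n` sending `hᵢ` to `b i`. -/
def liftUbar {B : Type*} [CommRing B] [Algebra K B] (b : Fin n → B)
    (hb : ∀ i j, i ≠ j → ∀ k : ℤ, IsUnit (b i - b j + (k : B))) : Ubar K n →ₐ[K] B :=
  IsLocalization.liftAlgHom (M := denominators K n) (f := aeval b) (by
    rintro ⟨y, hy⟩
    change IsUnit (aeval b y)
    induction hy using Submonoid.closure_induction with
    | mem y hy =>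
      obtain ⟨i, j, hij, k, rfl⟩ := hy
      simpa using hb i j hij k
    | one => simp
    | mul y z _ _ hy hz => rw [map_mul]; exact hy.mul hz)

theorem liftUbar_algebraMap {B : Type*} [CommRing B] [Algebra K B] (b : Fin n → B)
    (hb : ∀ i j, i ≠ j → ∀ k : ℤ, IsUnit (b i - b j + (k : B))) (p : MvPolynomial (Fin n) K) :
    liftUbar b hb (algebraMap _ (Ubar K n) p) = aeval b p := by
  rw [liftUbar, IsLocalization.liftAlgHom_apply, IsLocalization.lift_eq]
  rfl

@[simp]
theorem liftUbar_h {B : Type*} [CommRing B] [Algebra K B] (b : Fin n → B)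
    (hb : ∀ i j, i ≠ j → ∀ k : ℤ, IsUnit (b i - b j + (k : B))) (i : Fin n) :
    liftUbar b hb (h K i) = b i := by
  rw [h, liftUbar_algebraMap, aeval_X]

theorem Ubar_algHom_ext {B : Type*} [Semiring B] [Algebra K B] {f g : Ubar K n →ₐ[K] B}
    (hfg : ∀ i, f (h K i) = g (h K i)) : f = g := by
  apply IsLocalization.algHom_ext (denominators K n)
  apply MvPolynomial.algHom_ext
  exact hfg

/-- The automorphism of `Ubar K n` sending `hᵢ` to `hᵢ + cᵢ`. -/
def shift (c : Fin n → ℤ) : Ubar K n →ₐ[K] Ubar K n :=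
  liftUbar (fun i => h K i + (c i : Ubar K n)) (fun i j hij k => by
    have h1 : h K i + (c i : Ubar K n) - (h K j + (c j : Ubar K n)) + (k : Ubar K n) =
        h K i - h K j + ((c i - c j + k : ℤ) : Ubar K n) := by
      push_cast
      ring
    rw [h1]
    exact isUnit_h_sub_h_add i j hij _)

@[simp]
theorem shift_h (c : Fin n → ℤ) (i : Fin n) : shift c (h K i) = h K i + (c i : Ubar K n) :=
  liftUbar_h _ _ _

@[simp]
theorem shift_shift (c c' : Fin n → ℤ) (f : Ubar K n) :
    shift c (shift c' f) = shift (c + c') f := by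
  rw [← AlgHom.comp_apply]
  congr 1
  apply Ubar_algHom_ext
  intro i
  simp
  ring

@[simp]
theorem shift_zero (f : Ubar K n) : shift 0 f = f := by
  conv_rhs => rw [← AlgHom.id_apply (R := K) f]
  congr 1
  apply Ubar_algHom_ext
  intro i
  simp

theorem shift_injective (c : Fin n → ℤ) : Function.Injective (shift (K := K) c) := by
  intro f g hfg
  have := congrArg (shift (-c)) hfg
  simpa using this

variable [CharZero K]

/-- The fractional parts i/(n+1) are distinct for distinct i < n, so two coordinates of a grid point
never differ by an integer. -/
theorem isUnit_grid (m : Fin n → ℤ) (i j : Fin n) (hij : i ≠ j) (k : ℤ) :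
    IsUnit ((((i : ℕ) : K) / ((n : K) + 1) + (m i : K)) - (((j : ℕ) : K) / ((n : K) + 1) + (m j : K))
      + (k : K)) := by
  rw [isUnit_iff_ne_zero]
  intro h0
  have hn : (n : K) + 1 ≠ 0 := by exact_mod_cast Nat.succ_ne_zero n
  field_simp at h0
  have h1 : ((i : ℕ) : ℤ) + ((n : ℤ) + 1) * m i - (((j : ℕ) : ℤ) + ((n : ℤ) + 1) * m j)
      + ((n : ℤ) + 1) * k = 0 := by
    have h2 : ((((i : ℕ) : ℤ) + ((n : ℤ) + 1) * m i - (((j : ℕ) : ℤ) + ((n : ℤ) + 1) * m j)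
      + ((n : ℤ) + 1) * k : ℤ) : K) = 0 := by
      push_cast
      linear_combination h0
    exact_mod_cast h2
  have h3 : ((j : ℕ) : ℤ) - ((i : ℕ) : ℤ) = ((n : ℤ) + 1) * (m i - m j + k) := by
    linear_combination -h1
  have hi := i.2
  have hj := j.2
  have h4 : m i - m j + k = 0 := by
    by_contra h5
    rcases lt_or_gt_of_ne h5 with h6 | h6
    · nlinarith
    · nlinarith
  rw [h4] at h3
  apply hij
  ext
  omega

/-- Evaluation at the point `m` of a shifted integer grid on which no denominator vanishes. -/
def gridEval (m : Fin n → ℤ) : Ubar K n →ₐ[K] K :=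
  liftUbar (fun i => ((i : ℕ) : K) / ((n : K) + 1) + (m i : K)) (isUnit_grid m)

theorem gridEval_shift (m c : Fin n → ℤ) (f : Ubar K n) :
    gridEval m (shift c f) = gridEval (m + c) f := by
  rw [← AlgHom.comp_apply]
  congr 1
  apply Ubar_algHom_ext
  intro i
  simp [gridEval]
  ring

variable (K n) in
-- If 0 were a denominator, it would be invertible in `Ubar K n`, and a grid evaluation would make 0
-- invertible in K.
theorem denominators_le_nonZeroDivisors :
    denominators K n ≤ nonZeroDivisors (MvPolynomial (Fin n) K) := by
  apply le_nonZeroDivisors_of_noZeroDivisors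
  intro h0
  have := (IsLocalization.map_units (Ubar K n) (⟨0, h0⟩ : denominators K n)).map
    (gridEval (K := K) (n := n) 0)
  simp at this

instance : IsDomain (Ubar K n) :=
  IsLocalization.isDomain_localization (denominators_le_nonZeroDivisors K n)

/-- The grid is a product of infinite subsets of K, and a polynomial vanishing on such a product is
zero; this is applied to the numerator. -/
theorem eq_zero_of_gridEval (f : Ubar K n) (hf : ∀ m, gridEval m f = 0) : f = 0 := by
  obtain ⟨p, q, rfl⟩ := IsLocalization.exists_mk'_eq (denominators K n) f
  suffices hp : p = 0 by rw [hp, IsLocalization.mk'_zero]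
  have hp : ∀ m : Fin n → ℤ,
      aeval (fun i : Fin n => ((i : ℕ) : K) / ((n : K) + 1) + (m i : K)) p = 0 := by
    intro m
    have h1 := hf m
    have h2 : gridEval (K := K) m (algebraMap _ _ p) = 0 := by
      rw [← IsLocalization.mk'_spec (Ubar K n) p q, map_mul, h1, zero_mul]
    rwa [gridEval, liftUbar_algebraMap] at h2
  apply MvPolynomial.funext_set
    (fun i : Fin n => Set.range fun m : ℤ => ((i : ℕ) : K) / ((n : K) + 1) + (m : K))
  · intro i
    apply Set.infinite_range_of_injective
    intro a b hab
    simpa using hab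
  · intro y hy
    choose m hm using fun i => hy i (Set.mem_univ i)
    rw [map_zero, ← hp m, aeval_eq_eval]
    congr 2
    exact (funext hm).symm

/-- A shift-invariant element of `Ubar K n` is a scalar. -/
theorem eq_algebraMap_of_shift (f : Ubar K n) (hf : ∀ i, shift (Pi.single i 1) f = f) :
    ∃ c : K, f = algebraMap K _ c := by
  have hS : ∀ m : Fin n → ℤ, shift m f = f := by
    have h1 : ∀ i, ∀ k : ℤ, shift (Pi.single i k) f = f := by
      intro i k
      induction k using Int.induction_on with
      | zero => simp
      | succ k ih => rw [Pi.single_add, ← shift_shift, hf, ih]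
      | pred k ih =>
        apply shift_injective (Pi.single i 1)
        rw [shift_shift, ← Pi.single_add, hf]
        simpa using ih
    intro m
    have h2 : ∀ s : Finset (Fin n), shift (∑ i ∈ s, Pi.single i (m i)) f = f := by
      intro s
      induction s using Finset.induction_on with
      | empty => simp
      | insert i s hi ih => rw [Finset.sum_insert hi, ← shift_shift, ih, h1]
    simpa [Finset.univ_sum_single] using h2 Finset.univ
  -- Invariance under all integer shifts makes f take the same value at every grid point, so the
  -- scalar is the value at any one of them.
  refine ⟨gridEval 0 f, ?_⟩
  rw [← sub_eq_zero]
  apply eq_zero_of_gridEval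
  intro m
  have h1 := gridEval_shift 0 m f
  rw [hS m, zero_add] at h1
  rw [map_sub, AlgHom.commutes, ← h1]
  exact sub_self _

end Ubar

/-! ### The R-matrix and contractions with it -/

section RMatrix

variable (K : Type*) [Field K] {n : ℕ}

/-- The diagonal component `Rhat i j i j` of the R-matrix. -/
def rdiag (i j : Fin n) : Ubar K n :=
  if i = j then 0 else Ring.inverse (h K i - h K j)

/-- The component `Rhat i j j i` of the R-matrix. -/
def rswap (i j : Fin n) : Ubar K n :=
  if i < j then ((h K i - h K j) ^ 2 - 1) * Ring.inverse ((h K i - h K j) ^ 2) else 1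

theorem Rhat_eq (i j k l : Fin n) :
    Rhat K i j k l =
      (if k = i ∧ l = j then rdiag K i j else 0) + (if k = j ∧ l = i then rswap K i j else 0) := by
  unfold Rhat rdiag rswap
  by_cases hij : i = j
  · subst hij
    simp
  · by_cases h1 : k = i ∧ l = j
    · have h2 : ¬ (k = j ∧ l = i) := fun h2 => hij (h1.1.symm.trans h2.1)
      simp [hij, h1]
    · simp [hij, h1]

/-- The function g stands for any expression additive in its coefficient, so the same collapse of
the double sum serves both the algebra and operators on the Fock space, wherever the coefficient is
placed. -/
theorem sum_upper_Rhat {M : Type*} [AddCommMonoid M] (g : Fin n → Fin n → Ubar K n → M)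
    (h0 : ∀ a b, g a b 0 = 0) (hadd : ∀ a b f f', g a b (f + f') = g a b f + g a b f')
    (i j : Fin n) :
    ∑ k, ∑ l, g k l (Rhat K i j k l) = g i j (rdiag K i j) + g j i (rswap K i j) := by
  simp only [Rhat_eq, hadd, Finset.sum_add_distrib]
  congr 1
  · rw [Finset.sum_eq_single i, Finset.sum_eq_single j] <;> simp +contextual [h0]
  · rw [Finset.sum_eq_single j, Finset.sum_eq_single i] <;> simp +contextual [h0]

theorem sum_lower_Rhat {M : Type*} [AddCommMonoid M] (g : Fin n → Fin n → Ubar K n → M)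
    (h0 : ∀ a b, g a b 0 = 0) (hadd : ∀ a b f f', g a b (f + f') = g a b f + g a b f')
    (k l : Fin n) :
    ∑ i, ∑ j, g i j (Rhat K i j k l) = g k l (rdiag K k l) + g l k (rswap K l k) := by
  simp only [Rhat_eq, hadd, Finset.sum_add_distrib]
  congr 1
  · rw [Finset.sum_eq_single k, Finset.sum_eq_single l] <;>
      simp +contextual [h0, eq_comm]
  · rw [Finset.sum_eq_single l, Finset.sum_eq_single k] <;>
      simp +contextual [h0, eq_comm]

theorem sum_mixed_Rhat {M : Type*} [AddCommMonoid M] (g : Fin n → Fin n → Ubar K n → M)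
    (h0 : ∀ a b, g a b 0 = 0) (hadd : ∀ a b f f', g a b (f + f') = g a b f + g a b f')
    (i j : Fin n) :
    ∑ k, ∑ l, g k l (Rhat K k i l j) =
      g j i (rswap K j i) + if i = j then ∑ k, g k k (rdiag K k i) else 0 := by
  simp only [Rhat_eq, hadd, Finset.sum_add_distrib]
  rw [add_comm]
  congr 1
  · rw [Finset.sum_eq_single j, Finset.sum_eq_single i] <;>
      simp +contextual [h0, eq_comm]
  · by_cases hij : i = j
    · subst hij
      rw [if_pos rfl]
      refine Finset.sum_congr rfl fun k _ => ?_
      rw [Finset.sum_eq_single k] <;> simp +contextual [h0]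
    · simp [hij, Ne.symm hij, h0]

@[simp] theorem rdiag_self (i : Fin n) : rdiag K i i = 0 := by simp [rdiag]

@[simp] theorem rswap_self (i : Fin n) : rswap K i i = 1 := by simp [rswap]

theorem sub_mul_rdiag {i j : Fin n} (hij : i ≠ j) : (h K i - h K j) * rdiag K i j = 1 := by
  rw [rdiag, if_neg hij, Ring.mul_inverse_cancel _ (isUnit_h_sub_h K hij)]

end RMatrix

/-! ### Rational functions and shifted R-matrix entries -/

section FractionField

variable (K : Type*) [Field K] [CharZero K] (n : ℕ)

/-- The field of rational functions in the `hᵢ`. -/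
def Fr : Type _ := FractionRing (Ubar K n)

instance : Field (Fr K n) := inferInstanceAs (Field (FractionRing (Ubar K n)))

instance : Algebra K (Fr K n) := inferInstanceAs (Algebra K (FractionRing (Ubar K n)))

instance : Algebra (Ubar K n) (Fr K n) :=
  inferInstanceAs (Algebra (Ubar K n) (FractionRing (Ubar K n)))

instance : IsFractionRing (Ubar K n) (Fr K n) :=
  inferInstanceAs (IsFractionRing (Ubar K n) (FractionRing (Ubar K n)))

instance : IsScalarTower K (Ubar K n) (Fr K n) :=
  inferInstanceAs (IsScalarTower K (Ubar K n) (FractionRing (Ubar K n)))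

variable {n}

/-- The variable `hᵢ` as a rational function. -/
def hF (i : Fin n) : Fr K n := algebraMap (Ubar K n) (Fr K n) (h K i)

theorem hF_sub_add_ne_zero {i j : Fin n} (hij : i ≠ j) (c : ℤ) :
    hF K i - hF K j + (c : Fr K n) ≠ 0 := by
  have := (isUnit_h_sub_h_add (K := K) i j hij c).map (algebraMap (Ubar K n) (Fr K n))
  simpa [hF] using this.ne_zero

variable {K}

theorem algHom_comp_shift_injective (c : Fin n → ℤ) :
    Function.Injective ((Algebra.algHom K (Ubar K n) (Fr K n)).comp (shift c)) := by
  rw [AlgHom.coe_comp]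
  exact (IsFractionRing.injective (Ubar K n) (Fr K n)).comp (shift_injective c)

/-- The automorphism of the field of rational functions sending `hᵢ` to `hᵢ + cᵢ`. -/
def shiftF (c : Fin n → ℤ) : Fr K n →ₐ[K] Fr K n :=
  IsFractionRing.liftAlgHom (A := Ubar K n) (algHom_comp_shift_injective c)

@[simp]
theorem shiftF_algebraMap (c : Fin n → ℤ) (f : Ubar K n) :
    shiftF c (algebraMap (Ubar K n) (Fr K n) f) = algebraMap _ _ (shift c f) := by
  rw [shiftF, IsFractionRing.liftAlgHom_apply, IsFractionRing.lift_algebraMap]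
  rfl

@[simp]
theorem shiftF_hF (c : Fin n → ℤ) (i : Fin n) : shiftF c (hF K i) = hF K i + (c i : Fr K n) := by
  simp [hF]

@[simp]
theorem shiftF_shiftF (c c' : Fin n → ℤ) (f : Fr K n) :
    shiftF c (shiftF c' f) = shiftF (c + c') f := by
  obtain ⟨p, q, hq, rfl⟩ := IsFractionRing.div_surjective (A := Ubar K n) f
  simp [map_div₀]

@[simp]
theorem shiftF_zero (f : Fr K n) : shiftF 0 f = f := by
  obtain ⟨p, q, hq, rfl⟩ := IsFractionRing.div_surjective (A := Ubar K n) f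
  simp [map_div₀]

variable (K) in
/-- The shifted diagonal component of the R-matrix as a rational function. -/
def rF (i j : Fin n) (c : ℤ) : Fr K n :=
  if i = j then 0 else (hF K i - hF K j + (c : Fr K n))⁻¹

variable (K) in
/-- The shifted off-diagonal component of the R-matrix as a rational function. -/
def rhoF (i j : Fin n) (c : ℤ) : Fr K n :=
  if i < j then 1 - ((hF K i - hF K j + (c : Fr K n))⁻¹) ^ 2 else 1

@[simp] theorem rF_self (i : Fin n) (c : ℤ) : rF K i i c = 0 := by simp [rF]

@[simp] theorem rhoF_self (i : Fin n) (c : ℤ) : rhoF K i i c = 1 := by simp [rhoF]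

theorem rF_of_ne {i j : Fin n} (hij : i ≠ j) (c : ℤ) :
    rF K i j c = (hF K i - hF K j + (c : Fr K n))⁻¹ := by simp [rF, hij]

theorem mul_rF {i j : Fin n} (hij : i ≠ j) (c : ℤ) :
    (hF K i - hF K j + (c : Fr K n)) * rF K i j c = 1 := by
  rw [rF_of_ne hij, mul_inv_cancel₀ (hF_sub_add_ne_zero K hij c)]

@[simp]
theorem shiftF_rF (v : Fin n → ℤ) (i j : Fin n) (c : ℤ) :
    shiftF v (rF K i j c) = rF K i j (c + v i - v j) := by
  by_cases hij : i = j
  · simp [rF, hij]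
  · simp only [rF, hij, if_false, map_inv₀, map_add, map_sub, shiftF_hF, map_intCast]
    congr 1
    push_cast
    ring

@[simp]
theorem shiftF_rhoF (v : Fin n → ℤ) (i j : Fin n) (c : ℤ) :
    shiftF v (rhoF K i j c) = rhoF K i j (c + v i - v j) := by
  by_cases hij : i < j
  · simp only [rhoF, hij, if_true, map_inv₀, map_add, map_sub, shiftF_hF, map_intCast, map_pow,
      map_one]
    congr 3
    push_cast
    ring
  · simp [rhoF, hij]

/-- One of the two factors is always 1, which one depending on the order of i and j. The product
does not depend on the order, so later coefficient identities need no case distinction on it. -/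
theorem rhoF_mul_rhoF_eq {i j : Fin n} (hij : i ≠ j) {c c' : ℤ} (hc : c + c' = 0) :
    rhoF K i j c * rhoF K j i c' = 1 - ((hF K i - hF K j + (c : Fr K n))⁻¹) ^ 2 := by
  obtain rfl : c' = -c := by omega
  rcases lt_or_gt_of_ne hij with h1 | h1
  · simp [rhoF, h1, h1.not_gt]
  · have h2 : hF K j - hF K i + ((-c : ℤ) : Fr K n) = -(hF K i - hF K j + (c : Fr K n)) := by
      push_cast
      ring
    simp only [rhoF, h1, h1.not_gt, if_true, if_false, one_mul, h2, inv_neg, neg_sq]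

theorem rhoF_mul_rhoF {i j : Fin n} (hij : i ≠ j) {c c' : ℤ} (hc : c + c' = 0) :
    (hF K i - hF K j + (c : Fr K n)) ^ 2 * (rhoF K i j c * rhoF K j i c') =
      (hF K i - hF K j + (c : Fr K n)) ^ 2 - 1 := by
  have h1 := hF_sub_add_ne_zero K hij c
  rw [rhoF_mul_rhoF_eq hij hc]
  field_simp

theorem algebraMap_rdiag (i j : Fin n) :
    algebraMap (Ubar K n) (Fr K n) (rdiag K i j) = rF K i j 0 := by
  by_cases hij : i = j
  · simp [rdiag, rF, hij]
  · rw [rF_of_ne hij]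
    apply eq_inv_of_mul_eq_one_right
    rw [Int.cast_zero, add_zero, hF, hF, ← map_sub, ← map_mul, sub_mul_rdiag K hij, map_one]

theorem algebraMap_rswap (i j : Fin n) :
    algebraMap (Ubar K n) (Fr K n) (rswap K i j) = rhoF K i j 0 := by
  by_cases hij : i < j
  · have h1 := isUnit_h_sub_h K hij.ne
    have h2 := (h1.pow 2)
    have h3 := hF_sub_add_ne_zero K hij.ne 0
    have h4 : algebraMap (Ubar K n) (Fr K n) (Ring.inverse ((h K i - h K j) ^ 2)) =
        ((hF K i - hF K j + ((0 : ℤ) : Fr K n)) ^ 2)⁻¹ := by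
      apply eq_inv_of_mul_eq_one_right
      rw [Int.cast_zero, add_zero, hF, hF, ← map_sub, ← map_pow, ← map_mul,
        Ring.mul_inverse_cancel _ h2, map_one]
    simp only [rswap, rhoF, hij, if_true, map_mul, h4]
    rw [map_sub, map_pow, map_sub, map_one]
    change ((hF K i - hF K j) ^ 2 - 1) * _ = _
    rw [Int.cast_zero, add_zero] at *
    field_simp
  · simp [rswap, rhoF, hij]

end FractionField

/-! ### The Fock space and the ∂∂ relations on vectors -/

section FockSpace

variable (K : Type*) [Field K] [CharZero K] (n N : ℕ)

/-- Generators of the algebra of `h`-deformed derivatives over the field of rational functions. -/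
inductive FockGen : Type _
  | coeff (f : Fr K n) : FockGen
  | d (i : Fin n) (α : Fin N) : FockGen

variable {K n N} in
/-- A coefficient in the free algebra. -/
def ffc (f : Fr K n) : FreeAlgebra K (FockGen K n N) := FreeAlgebra.ι K (FockGen.coeff f)

variable {n N} in
/-- A derivative in the free algebra. -/
def ffd (i : Fin n) (α : Fin N) : FreeAlgebra K (FockGen K n N) :=
  FreeAlgebra.ι K (FockGen.d i α)

/-- Defining relations of the algebra of `h`-deformed derivatives. -/
inductive FockRel : FreeAlgebra K (FockGen K n N) → FreeAlgebra K (FockGen K n N) → Prop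
  | coeff_algebraMap (c : K) :
      FockRel (ffc (algebraMap K (Fr K n) c)) (algebraMap K _ c)
  | coeff_add (f g : Fr K n) : FockRel (ffc (f + g)) (ffc f + ffc g)
  | coeff_mul (f g : Fr K n) : FockRel (ffc (f * g)) (ffc f * ffc g)
  | weight (j : Fin n) (α : Fin N) (f : Fr K n) :
      FockRel (ffd K j α * ffc f) (ffc (shiftF (Pi.single j 1) f) * ffd K j α)
  | d_d (k l : Fin n) (α β : Fin N) :
      FockRel (ffd K l α * ffd K k β)
        (ffc (rF K k l 0) * (ffd K l β * ffd K k α) + ffc (rhoF K l k 0) * (ffd K k β * ffd K l α))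

/-- The algebra of `h`-deformed derivatives, which serves as a Fock space. -/
abbrev Fock : Type _ := RingQuot (FockRel K n N)

/-- The action of a coefficient on the Fock space. -/
def fockC : Fr K n →ₐ[K] Fock K n N :=
  AlgHom.ofLinearMap
    { toFun := fun f => RingQuot.mkAlgHom K (FockRel K n N) (ffc f)
      map_add' := fun f g => by
        rw [RingQuot.mkAlgHom_rel K (FockRel.coeff_add f g), map_add]
      map_smul' := fun c f => by
        rw [Algebra.smul_def, RingQuot.mkAlgHom_rel K (FockRel.coeff_mul _ f), map_mul,
          RingQuot.mkAlgHom_rel K (FockRel.coeff_algebraMap c), AlgHom.commutes,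
          Algebra.smul_def, RingHom.id_apply] }
    (by
      change RingQuot.mkAlgHom K (FockRel K n N) (ffc 1) = 1
      rw [← map_one (algebraMap K (Fr K n)),
        RingQuot.mkAlgHom_rel K (FockRel.coeff_algebraMap 1), map_one, map_one])
    (fun f g => by
      change RingQuot.mkAlgHom K (FockRel K n N) (ffc (f * g)) =
        RingQuot.mkAlgHom K (FockRel K n N) (ffc f) * RingQuot.mkAlgHom K (FockRel K n N) (ffc g)
      rw [RingQuot.mkAlgHom_rel K (FockRel.coeff_mul f g), map_mul])

instance : Module (Fr K n) (Fock K n N) := Module.compHom _ (fockC K n N).toRingHom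

variable {K n N}

theorem fock_smul_def (f : Fr K n) (y : Fock K n N) : f • y = fockC K n N f * y := rfl

/-- Multiplication by a coefficient as a linear operator. -/
def fockSmul (f : Fr K n) : Fock K n N →ₗ[K] Fock K n N :=
  LinearMap.mulLeft K (fockC K n N f)

theorem fockSmul_apply (f : Fr K n) (y : Fock K n N) : fockSmul f y = f • y := rfl

/-- The operator `∂_{iα}` on the Fock space. -/
def fockD (i : Fin n) (α : Fin N) : Fock K n N →ₗ[K] Fock K n N :=
  LinearMap.mulLeft K (RingQuot.mkAlgHom K (FockRel K n N) (ffd K i α))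

theorem fockD_smul (j : Fin n) (α : Fin N) (f : Fr K n) (y : Fock K n N) :
    fockD j α (f • y) = shiftF (Pi.single j 1) f • fockD j α y := by
  have := RingQuot.mkAlgHom_rel K (FockRel.weight (K := K) j α f)
  rw [map_mul, map_mul] at this
  simp only [fock_smul_def, fockD, LinearMap.mulLeft_apply, ← mul_assoc]
  exact congrArg (· * y) this

theorem fockD_fockD (k l : Fin n) (α β : Fin N) (y : Fock K n N) :
    fockD l α (fockD k β y) =
      rF K k l 0 • fockD l β (fockD k α y) + rhoF K l k 0 • fockD k β (fockD l α y) := by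
  have := RingQuot.mkAlgHom_rel K (FockRel.d_d (K := K) k l α β)
  simp only [map_mul, map_add] at this
  simp only [fock_smul_def, fockD, LinearMap.mulLeft_apply, ← mul_assoc, ← add_mul]
  exact congrArg (· * y) (this.trans (by simp only [← mul_assoc]; rfl))

/-- An induction principle for the Fock space. -/
theorem fock_induction {P : Fock K n N → Prop} (one : P 1)
    (add : ∀ y z, P y → P z → P (y + z)) (smul : ∀ (f : Fr K n) y, P y → P (f • y))
    (deriv : ∀ i α y, P y → P (fockD i α y)) (y : Fock K n N) : P y := by
  obtain ⟨a, rfl⟩ := RingQuot.mkAlgHom_surjective K (FockRel K n N) y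
  -- Generalizing from 1 to every z satisfying P lets a product act factor by factor from the left.
  suffices hP : ∀ z, P z → P (RingQuot.mkAlgHom K (FockRel K n N) a * z) by
    simpa using hP 1 one
  induction a using FreeAlgebra.induction with
  | grade0 c =>
    intro z hz
    rw [AlgHom.commutes, ← AlgHom.commutes (fockC K n N)]
    exact smul _ z hz
  | grade1 g =>
    intro z hz
    cases g with
    | coeff f => exact smul f z hz
    | d i α => exact deriv i α z hz
  | mul a b ha hb =>
    intro z hz
    rw [map_mul, mul_assoc]
    exact ha _ (hb _ hz)
  | add a b ha hb =>
    intro z hz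
    rw [map_add, add_mul]
    exact add _ _ (ha _ hz) (hb _ hz)

/-- The action of a coefficient on vectors of elements of the Fock space, twisted by the weights of
the coordinates `x^{iα}`. -/
def vecSmul (f : Fr K n) : (Fin n →₀ Fock K n N) →ₗ[K] (Fin n →₀ Fock K n N) :=
  Finsupp.lsum K fun m => Finsupp.lsingle m ∘ₗ fockSmul (shiftF (Pi.single m (-1)) f)

@[simp]
theorem vecSmul_single (f : Fr K n) (m : Fin n) (w : Fock K n N) :
    vecSmul f (Finsupp.single m w) = shiftF (Pi.single m (-1)) f • Finsupp.single m w := by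
  simp [vecSmul, fockSmul_apply]

/-- The homogeneous part of the commutation of a coordinate with `∂_{jβ}`. -/
def vecD (j : Fin n) (β : Fin N) : (Fin n →₀ Fock K n N) →ₗ[K] (Fin n →₀ Fock K n N) :=
  Finsupp.lsum K fun m => Finsupp.lsingle m ∘ₗ fockSmul (rhoF K j m 1) ∘ₗ fockD j β +
    Finsupp.lsingle j ∘ₗ fockSmul (rF K m j 1) ∘ₗ fockD m β

-- The argument 1 in both coefficients arises from moving them to the left of the derivative in the
-- cross relation, which shifts their first variable by one.
@[simp]
theorem vecD_single (j : Fin n) (β : Fin N) (m : Fin n) (w : Fock K n N) :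
    vecD j β (Finsupp.single m w) = rhoF K j m 1 • Finsupp.single m (fockD j β w) +
      rF K m j 1 • Finsupp.single j (fockD m β w) := by
  simp [vecD, fockSmul_apply]

/-- The homogeneous part of moving a coordinate past two derivatives must respect their exchange
relation: a dynamical Yang-Baxter identity, checked for each pattern of coincidences among k, l, m.
The relations `e1`, `e2`, … bring the products of derivatives to a common set, and the coefficients
are compared as rational functions. -/
theorem vecD_vecD_single (k l : Fin n) (α β : Fin N) (m : Fin n) (w : Fock K n N) :
    vecD l α (vecD k β (Finsupp.single m w)) =
      vecSmul (rF K k l 0) (vecD l β (vecD k α (Finsupp.single m w))) +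
      vecSmul (rhoF K l k 0) (vecD k β (vecD l α (Finsupp.single m w))) := by
  by_cases hkl : k = l
  · subst hkl
    by_cases hmk : m = k
    · subst hmk
      have e1 := fockD_fockD m m α β w
      simp at e1 ⊢
      simp [e1]
    · have e1 := fockD_fockD k k α β w
      have e2 := fockD_fockD k m α β w
      have e3 := fockD_fockD m k α β w
      simp [fockD_smul, hmk, Ne.symm hmk] at e1 ⊢
      rw [e1, e2, e3]
      simp only [Finsupp.single_add, ← Finsupp.smul_single]
      clear e1 e2 e3
      have q1 := mul_rF (K := K) hmk 0
      have q2 := mul_rF (K := K) hmk 1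
      have q3 := mul_rF (K := K) (Ne.symm hmk) 0
      have q4 := rhoF_mul_rhoF (K := K) hmk (add_zero 0)
      match_scalars
      all_goals grind
  · by_cases hmk : m = k
    · subst hmk
      have e1 := fockD_fockD m m α β w
      have e2 := fockD_fockD m l α β w
      simp [fockD_smul, hkl, Ne.symm hkl] at e1 ⊢
      rw [e1, e2]
      simp only [Finsupp.single_add, ← Finsupp.smul_single]
      clear e1 e2
      have q1 := mul_rF (K := K) hkl 0
      have q2 := mul_rF (K := K) hkl 1
      have q3 := mul_rF (K := K) hkl (-1)
      have q4 := mul_rF (K := K) hkl 2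
      have q5 := mul_rF (K := K) (Ne.symm hkl) 1
      have q6 := rhoF_mul_rhoF (K := K) hkl (add_neg_cancel 1)
      match_scalars
      all_goals grind
    · by_cases hml : m = l
      · subst hml
        have e1 := fockD_fockD m m α β w
        have e2 := fockD_fockD m k α β w
        have e3 := fockD_fockD k m α β w
        simp [fockD_smul, hkl, Ne.symm hkl] at e1 ⊢
        rw [e1, e2, e3]
        simp only [Finsupp.single_add, ← Finsupp.smul_single]
        clear e1 e2 e3
        have q1 := mul_rF (K := K) hkl 0
        have q2 := mul_rF (K := K) hkl 1
        have q3 := mul_rF (K := K) hkl (-1)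
        have q4 := mul_rF (K := K) (Ne.symm hkl) 0
        have q5 := mul_rF (K := K) (Ne.symm hkl) 1
        have q6 := mul_rF (K := K) (Ne.symm hkl) 2
        have q7 := rhoF_mul_rhoF (K := K) hkl (add_neg_cancel 1)
        have q8 := rhoF_mul_rhoF (K := K) hkl (add_zero 0)
        match_scalars
        all_goals grind
      · have e1 := fockD_fockD k l α β w
        have e2 := fockD_fockD k m α β w
        have e3 := fockD_fockD m k α β w
        have e4 := fockD_fockD m l α β w
        simp [fockD_smul, hkl, Ne.symm hkl, hmk, Ne.symm hmk, hml, Ne.symm hml]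
        rw [e1, e2, e3, e4]
        simp only [Finsupp.single_add, ← Finsupp.smul_single]
        clear e1 e2 e3 e4
        have q1 := mul_rF (K := K) hkl 0
        have q2 := mul_rF (K := K) hkl 1
        have q3 := mul_rF (K := K) hkl (-1)
        have q4 := mul_rF (K := K) (Ne.symm hkl) 1
        have q5 := mul_rF (K := K) hmk 0
        have q6 := mul_rF (K := K) (Ne.symm hmk) 0
        have q7 := mul_rF (K := K) hml 0
        have q8 := mul_rF (K := K) hml 1
        have q9 := rhoF_mul_rhoF (K := K) hkl (add_neg_cancel 1)
        have q10 := rhoF_mul_rhoF (K := K) hmk (add_zero 0)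
        have q11 := mul_rF (K := K) hmk 1
        match_scalars
        all_goals grind

end FockSpace

/-! ### The action of the coordinates on the Fock space -/

section FockModule

variable {K : Type*} [Field K] [CharZero K] {n N : ℕ}

instance : IsScalarTower K (Fr K n) (Fock K n N) :=
  IsScalarTower.of_algebraMap_smul fun c y => by
    rw [fock_smul_def, AlgHom.commutes, Algebra.smul_def]

variable (K n) in
/-- The constant term of the commutation of `x^{iα}` with `∂_{iβ}`. -/
def contraction (α β : Fin N) : Fr K n := if α = β then -1 else 0

@[simp]
theorem shiftF_contraction (c : Fin n → ℤ) (α β : Fin N) :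
    shiftF c (contraction K n α β) = contraction K n α β := by
  unfold contraction
  split_ifs <;> simp

/-- The action of a coefficient on pairs of a vector and an element of the Fock space. -/
def pairSmul (f : Fr K n) :
    Module.End K ((Fin n →₀ Fock K n N) × Fock K n N) :=
  (vecSmul f).prodMap (fockSmul f)

/-- The action of `∂_{jβ}` on pairs of a vector and an element of the Fock space, obtained by moving
the coordinates `x^{iγ}` to the right of `∂_{jβ}`. -/
def pairD (γ : Fin N) (j : Fin n) (β : Fin N) :
    Module.End K ((Fin n →₀ Fock K n N) × Fock K n N) :=
  LinearMap.prod ((vecD j β).coprod (Finsupp.lsingle j ∘ₗ fockSmul (contraction K n γ β)))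
    (fockD j β ∘ₗ LinearMap.snd K _ _)

@[simp]
theorem pairSmul_apply (f : Fr K n) (v : Fin n →₀ Fock K n N) (y : Fock K n N) :
    pairSmul f (v, y) = (vecSmul f v, f • y) := rfl

@[simp]
theorem pairD_apply (γ : Fin N) (j : Fin n) (β : Fin N) (v : Fin n →₀ Fock K n N)
    (y : Fock K n N) :
    pairD γ j β (v, y) =
      (vecD j β v + Finsupp.single j (contraction K n γ β • y), fockD j β y) := by
  simp [pairD, fockSmul_apply]

theorem pair_ext {f g : Module.End K ((Fin n →₀ Fock K n N) × Fock K n N)}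
    (h1 : ∀ m w, f (Finsupp.single m w, 0) = g (Finsupp.single m w, 0))
    (h2 : ∀ y, f (0, y) = g (0, y)) : f = g := by
  apply LinearMap.prod_ext
  · apply Finsupp.lhom_ext
    intro m w
    exact h1 m w
  · ext y : 1
    exact h2 y

/-- A pair (v, y) models ∑ v_i x^{iγ} + y with the coordinates kept formal. On vectors the relation
is `vecD_vecD_single`; on the second entry what has to match are the constant terms of the cross
relation. -/
theorem pairD_pairD (γ : Fin N) (k l : Fin n) (α β : Fin N) :
    (pairD γ l α * pairD γ k β : Module.End K ((Fin n →₀ Fock K n N) × Fock K n N)) =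
      pairSmul (rF K k l 0) * (pairD γ l β * pairD γ k α) +
      pairSmul (rhoF K l k 0) * (pairD γ k β * pairD γ l α) := by
  apply pair_ext
  · intro m w
    have := vecD_vecD_single k l α β m w
    simp only [Module.End.mul_apply, LinearMap.add_apply, pairD_apply, pairSmul_apply, map_zero,
      smul_zero, Finsupp.single_zero, add_zero, Prod.mk_add_mk]
    rw [this]
  · intro y
    have e1 := fockD_fockD k l α β y
    simp only [Module.End.mul_apply, LinearMap.add_apply, pairD_apply, pairSmul_apply, map_zero,
      zero_add, Prod.mk_add_mk, Prod.mk.injEq]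
    refine ⟨?_, e1⟩
    by_cases hkl : k = l
    · subst hkl
      simp [fockD_smul]
      simp only [← Finsupp.smul_single]
      module
    · have q1 := mul_rF (K := K) hkl 0
      have q2 := mul_rF (K := K) hkl 1
      have q3 := mul_rF (K := K) hkl (-1)
      have q4 := mul_rF (K := K) (Ne.symm hkl) 1
      have q5 := rhoF_mul_rhoF (K := K) hkl (add_neg_cancel 1)
      simp [hkl, Ne.symm hkl, fockD_smul]
      simp only [← Finsupp.smul_single]
      match_scalars
      all_goals grind

theorem pairD_pairSmul (γ : Fin N) (j : Fin n) (α : Fin N) (f : Fr K n) :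
    (pairD γ j α * pairSmul f : Module.End K ((Fin n →₀ Fock K n N) × Fock K n N)) =
      pairSmul (shiftF (Pi.single j 1) f) * pairD γ j α := by
  have h1 : ∀ a b : Fin n, (Pi.single a 1 : Fin n → ℤ) + Pi.single b (-1) =
      Pi.single b (-1) + Pi.single a 1 := fun a b => add_comm _ _
  have h2 : ∀ a : Fin n, (Pi.single a (-1) : Fin n → ℤ) + Pi.single a 1 = 0 := by
    intro a
    rw [← Pi.single_add]
    simp
  apply pair_ext
  · intro m w
    simp only [Module.End.mul_apply, pairD_apply, pairSmul_apply, map_zero, smul_zero,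
      Finsupp.single_zero, add_zero, vecSmul_single, Finsupp.smul_single, vecD_single, fockD_smul,
      map_add, shiftF_shiftF, h1, h2, shiftF_zero, Prod.mk.injEq, and_true]
    simp only [← Finsupp.smul_single]
    module
  · intro y
    simp [fockD_smul, smul_smul, mul_comm, h2]

/-- The action of the algebra of derivatives on pairs. -/
def pairHom (γ : Fin N) :
    Fock K n N →ₐ[K] Module.End K ((Fin n →₀ Fock K n N) × Fock K n N) :=
  RingQuot.liftAlgHom K ⟨FreeAlgebra.lift K fun g => match g with
    | FockGen.coeff f => pairSmul f
    | FockGen.d i α => pairD γ i α, by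
    intro a b hab
    induction hab with
    | coeff_algebraMap c =>
      simp only [ffc, FreeAlgebra.lift_ι_apply, AlgHom.commutes]
      apply pair_ext <;> intros <;> simp
    | coeff_add f g =>
      simp only [ffc, FreeAlgebra.lift_ι_apply, map_add]
      apply pair_ext <;> intros <;> simp [add_smul]
    | coeff_mul f g =>
      simp only [ffc, FreeAlgebra.lift_ι_apply, map_mul]
      apply pair_ext <;> intros <;> simp [mul_smul]
    | weight j α f =>
      simp only [ffc, ffd, FreeAlgebra.lift_ι_apply, map_mul]
      exact pairD_pairSmul γ j α f
    | d_d k l α β =>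
      simp only [ffc, ffd, FreeAlgebra.lift_ι_apply, map_mul, map_add]
      exact pairD_pairD γ k l α β⟩

theorem pairHom_fockC (γ : Fin N) (f : Fr K n) : pairHom γ (fockC K n N f) = pairSmul f := by
  change pairHom γ (RingQuot.mkAlgHom K (FockRel K n N) (ffc f)) = _
  simp [pairHom, ffc]

theorem pairHom_d (γ : Fin N) (j : Fin n) (β : Fin N) :
    pairHom γ (RingQuot.mkAlgHom K (FockRel K n N) (ffd K j β)) = pairD γ j β := by
  simp [pairHom, ffd]

/-- The coordinates `x^{iγ}` applied to an element of the Fock space, as a vector. -/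
def fockXvec (γ : Fin N) : Fock K n N →ₗ[K] (Fin n →₀ Fock K n N) :=
  LinearMap.fst K _ _ ∘ₗ LinearMap.applyₗ ((0, 1) : (Fin n →₀ Fock K n N) × Fock K n N) ∘ₗ
    (pairHom γ).toLinearMap

/-- Acting on (0, 1) recovers y in the second entry. Hence the first entry of the action of a
product can be computed from `fockXvec γ y`, which is how the commutation rules of `fockX` are
obtained. -/
theorem pairHom_apply (γ : Fin N) (y : Fock K n N) :
    pairHom γ y (0, 1) = (fockXvec γ y, y) := by
  refine Prod.ext rfl ?_
  induction y using fock_induction with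
  | one => simp
  | add y z hy hz => simp only [map_add, LinearMap.add_apply, Prod.snd_add, hy, hz]
  | smul f y hy =>
    rw [fock_smul_def, map_mul, pairHom_fockC, Module.End.mul_apply, ← Prod.mk.eta
      (p := pairHom γ y (0, 1)), pairSmul_apply, hy]
    rfl
  | deriv i α y hy =>
    rw [fockD, LinearMap.mulLeft_apply, map_mul, pairHom_d, Module.End.mul_apply, ← Prod.mk.eta
      (p := pairHom γ y (0, 1)), pairD_apply, hy]
    rfl

/-- The operator `x^{iγ}` on the Fock space. -/
def fockX (i : Fin n) (γ : Fin N) : Fock K n N →ₗ[K] Fock K n N :=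
  Finsupp.lapply i ∘ₗ fockXvec γ

theorem fockX_one (i : Fin n) (γ : Fin N) : fockX i γ (1 : Fock K n N) = 0 := by
  simp [fockX, fockXvec]

theorem vecSmul_apply (f : Fr K n) (v : Fin n →₀ Fock K n N) (i : Fin n) :
    vecSmul f v i = shiftF (Pi.single i (-1)) f • v i := by
  induction v using Finsupp.induction_linear with
  | zero => simp
  | add v w hv hw => rw [map_add, Finsupp.add_apply, hv, hw, Finsupp.add_apply, smul_add]
  | single m w =>
    rw [vecSmul_single]
    by_cases hm : m = i
    · subst hm
      simp
    · simp [hm]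

theorem vecD_apply (j : Fin n) (β : Fin N) (v : Fin n →₀ Fock K n N) (i : Fin n) :
    vecD j β v i = rhoF K j i 1 • fockD j β (v i) +
      if i = j then ∑ m, rF K m j 1 • fockD m β (v m) else 0 := by
  induction v using Finsupp.induction_linear with
  | zero => simp
  | add v w hv hw =>
    rw [map_add, Finsupp.add_apply, hv, hw]
    split_ifs
    · simp only [Finsupp.add_apply, map_add, smul_add, Finset.sum_add_distrib]
      abel
    · simp
  | single m w =>
    rw [vecD_single, Finsupp.add_apply, Finsupp.smul_apply, Finsupp.smul_apply]
    congr 1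
    · by_cases hm : m = i
      · subst hm
        simp
      · simp [hm]
    · by_cases hi : i = j
      · subst hi
        rw [if_pos rfl, Finset.sum_eq_single m]
        · simp
        · intro b _ hb
          simp [Ne.symm hb]
        · simp
      · simp [hi]

theorem fockX_smul (i : Fin n) (γ : Fin N) (f : Fr K n) (y : Fock K n N) :
    fockX i γ (f • y) = shiftF (Pi.single i (-1)) f • fockX i γ y := by
  have h1 : fockXvec γ (f • y) = vecSmul f (fockXvec γ y) := by
    have := pairHom_apply γ (f • y)
    rw [fock_smul_def, map_mul, pairHom_fockC, Module.End.mul_apply, pairHom_apply,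
      pairSmul_apply] at this
    exact (congrArg Prod.fst this).symm
  simp only [fockX, LinearMap.comp_apply, Finsupp.lapply_apply, h1, vecSmul_apply]

theorem fockX_fockD (i j : Fin n) (α β : Fin N) (y : Fock K n N) :
    fockX i α (fockD j β y) = rhoF K j i 1 • fockD j β (fockX i α y) +
      if i = j then (∑ m, rF K m j 1 • fockD m β (fockX m α y)) + contraction K n α β • y
      else 0 := by
  have h1 : fockXvec α (fockD j β y) = vecD j β (fockXvec α y) +
      Finsupp.single j (contraction K n α β • y) := by
    have := pairHom_apply α (fockD j β y)
    rw [fockD, LinearMap.mulLeft_apply, map_mul, pairHom_d, Module.End.mul_apply, pairHom_apply,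
      pairD_apply] at this
    exact (congrArg Prod.fst this).symm
  simp only [fockX, LinearMap.comp_apply, Finsupp.lapply_apply, h1, vecD_apply, Finsupp.add_apply]
  by_cases hij : i = j
  · subst hij
    simp [add_assoc]
  · simp [hij]

end FockModule

/-! ### The exchange relation of the coordinates -/

section FockModule

variable {K : Type*} [Field K] [CharZero K] {n N : ℕ}

theorem sum_eq_add_add_sum_erase {M : Type*} [AddCommMonoid M] {i j : Fin n} (hij : i ≠ j)
    (g : Fin n → M) : ∑ m, g m = g i + g j + ∑ m ∈ (Finset.univ.erase i).erase j, g m := by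
  rw [← Finset.add_sum_erase _ g (Finset.mem_univ i),
    ← Finset.add_sum_erase _ g (Finset.mem_erase.mpr ⟨hij.symm, Finset.mem_univ j⟩), add_assoc]

variable (K n N) in
/-- The exchange relation of the coordinates on an element of the Fock space. -/
def Exchange (y : Fock K n N) : Prop :=
  ∀ (i j : Fin n) (α β : Fin N), fockX i α (fockX j β y) =
    rF K i j 0 • fockX i β (fockX j α y) + rhoF K i j 0 • fockX j β (fockX i α y)

theorem exchange_fockD_of_ne {i j k : Fin n} (hki : k ≠ i) (hkj : k ≠ j) (α β γ : Fin N)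
    (y : Fock K n N) (hy : Exchange K n N y) :
    fockX i α (fockX j β (fockD k γ y)) =
      rF K i j 0 • fockX i β (fockX j α (fockD k γ y)) +
      rhoF K i j 0 • fockX j β (fockX i α (fockD k γ y)) := by
  have h1 := hy i j α β
  by_cases hij : i = j
  · subst hij
    simp [fockX_fockD, fockX_smul, hki, Ne.symm hki] at h1 ⊢
    rw [h1]
  · simp [fockX_fockD, fockX_smul, hki, Ne.symm hki, hkj, Ne.symm hkj, hij, Ne.symm hij]
    rw [h1]
    simp [fockD_smul, hki, hkj]
    module

theorem exchange_fockD_self (k : Fin n) (α β γ : Fin N) (y : Fock K n N)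
    (hy : Exchange K n N y) :
    fockX k α (fockX k β (fockD k γ y)) = fockX k β (fockX k α (fockD k γ y)) := by
  have h1 := hy k k α β
  simp [fockX_fockD, fockX_smul, Finset.sum_add_distrib] at h1 ⊢
  -- For m ≠ k a single term is not symmetric in α and β; the term from the first sum and the term
  -- from the second sum with the same m have to be combined.
  have hS : ∑ m, rF K m k 1 • fockD m γ (fockX m α (fockX k β y)) +
      ∑ m, rF K m k (1 + (Pi.single k (-1) : Fin n → ℤ) m + 1) •
        rhoF K m k 1 • fockD m γ (fockX k α (fockX m β y)) =
      ∑ m, rF K m k 1 • fockD m γ (fockX m β (fockX k α y)) +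
      ∑ m, rF K m k (1 + (Pi.single k (-1) : Fin n → ℤ) m + 1) •
        rhoF K m k 1 • fockD m γ (fockX k β (fockX m α y)) := by
    rw [← Finset.sum_add_distrib, ← Finset.sum_add_distrib]
    refine Finset.sum_congr rfl fun m _ => ?_
    by_cases hm : m = k
    · subst hm
      simp
    · rw [hy m k α β, hy k m α β]
      simp [fockD_smul, hm, Ne.symm hm]
      have q1 := mul_rF (K := K) hm 1
      have q2 := mul_rF (K := K) hm 2
      have q3 := mul_rF (K := K) (Ne.symm hm) (-1)
      have q4 := rhoF_mul_rhoF (K := K) hm (add_neg_cancel 1)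
      match_scalars
      all_goals grind
  rw [h1]
  linear_combination (norm := module) hS

theorem exchange_fockD_left {i j : Fin n} (hij : i ≠ j) (α β γ : Fin N) (y : Fock K n N)
    (hy : Exchange K n N y) :
    fockX i α (fockX j β (fockD i γ y)) =
      rF K i j 0 • fockX i β (fockX j α (fockD i γ y)) +
      rhoF K i j 0 • fockX j β (fockX i α (fockD i γ y)) := by
  have h1 := hy i j α β
  have h2 := hy j j α β
  -- Summands with m outside {i, j} are treated termwise through the exchange of m and j on y. The
  -- two exceptional summands join the remaining terms in the final comparison.
  have hS : ∑ m ∈ (Finset.univ.erase i).erase j,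
        rF K m i 1 • fockD m γ (fockX m α (fockX j β y)) =
      rF K i j 0 • ∑ m ∈ (Finset.univ.erase i).erase j,
        rF K m i 1 • fockD m γ (fockX m β (fockX j α y)) +
      ∑ m ∈ (Finset.univ.erase i).erase j, rF K m i (1 + (Pi.single j (-1) : Fin n → ℤ) m) •
        rhoF K m j 1 • fockD m γ (fockX j β (fockX m α y)) +
      rF K j i 0 • ∑ m ∈ (Finset.univ.erase i).erase j,
        rF K m j 1 • fockD m γ (fockX m β (fockX j α y)) := by
    simp only [Finset.smul_sum, ← Finset.sum_add_distrib]
    refine Finset.sum_congr rfl fun m hm => ?_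
    simp only [Finset.mem_erase, Finset.mem_univ, and_true] at hm
    rw [hy m j α β]
    simp [fockD_smul, hm.1, Ne.symm hm.1]
    have q1 := mul_rF (K := K) hm.2 1
    have q2 := mul_rF (K := K) hm.1 1
    have q3 := mul_rF (K := K) hij 0
    have q4 := mul_rF (K := K) (Ne.symm hij) 0
    match_scalars
    all_goals grind
  simp [fockX_fockD, fockX_smul, Finset.sum_add_distrib, hij, Ne.symm hij] at h2 ⊢
  simp only [sum_eq_add_add_sum_erase hij]
  rw [hS, h1, h2]
  simp [fockD_smul, hij, Ne.symm hij]
  have q1 := mul_rF (K := K) hij 0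
  have q2 := mul_rF (K := K) hij 1
  have q3 := mul_rF (K := K) (Ne.symm hij) 0
  have q4 := mul_rF (K := K) (Ne.symm hij) 1
  match_scalars
  all_goals grind

theorem exchange_fockD_right {i j : Fin n} (hij : i ≠ j) (α β γ : Fin N) (y : Fock K n N)
    (hy : Exchange K n N y) :
    fockX i α (fockX j β (fockD j γ y)) =
      rF K i j 0 • fockX i β (fockX j α (fockD j γ y)) +
      rhoF K i j 0 • fockX j β (fockX i α (fockD j γ y)) := by
  have h1 := hy i j α β
  have h2 := hy i i α β
  have hS : ∑ m ∈ (Finset.univ.erase i).erase j, rF K m j (1 + (Pi.single i (-1) : Fin n → ℤ) m) •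
        rhoF K m i 1 • fockD m γ (fockX i α (fockX m β y)) +
      rF K i j 0 • ∑ m ∈ (Finset.univ.erase i).erase j,
        rF K m i 1 • fockD m γ (fockX m α (fockX i β y)) =
      rF K i j 0 • ∑ m ∈ (Finset.univ.erase i).erase j,
        rF K m j (1 + (Pi.single i (-1) : Fin n → ℤ) m) •
          rhoF K m i 1 • fockD m γ (fockX i β (fockX m α y)) +
      rF K i j 0 • rF K i j 0 • ∑ m ∈ (Finset.univ.erase i).erase j,
        rF K m i 1 • fockD m γ (fockX m β (fockX i α y)) +
      rhoF K i j 0 • rhoF K j i 0 • ∑ m ∈ (Finset.univ.erase i).erase j,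
        rF K m j 1 • fockD m γ (fockX m β (fockX i α y)) := by
    simp only [Finset.smul_sum, ← Finset.sum_add_distrib]
    refine Finset.sum_congr rfl fun m hm => ?_
    simp only [Finset.mem_erase, Finset.mem_univ, and_true] at hm
    rw [hy m i α β, hy i m α β]
    simp [fockD_smul, hm.2, Ne.symm hm.2]
    have q1 := mul_rF (K := K) hm.2 1
    have q2 := mul_rF (K := K) hm.1 1
    have q3 := mul_rF (K := K) hij 0
    have q4 := mul_rF (K := K) (Ne.symm hm.2) (-1)
    have q5 := rhoF_mul_rhoF (K := K) hij (add_zero 0)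
    have q6 := rhoF_mul_rhoF (K := K) hm.2 (add_neg_cancel 1)
    match_scalars
    all_goals grind
  simp [fockX_fockD, fockX_smul, Finset.sum_add_distrib, hij, Ne.symm hij] at h2 ⊢
  simp only [sum_eq_add_add_sum_erase hij]
  rw [eq_sub_of_add_eq hS, h1, h2, hy j i α β]
  simp [fockD_smul, hij, Ne.symm hij, -Finset.sum_erase_eq_sub]
  have q1 := mul_rF (K := K) hij 0
  have q2 := mul_rF (K := K) hij 1
  have q3 := mul_rF (K := K) (Ne.symm hij) 0
  have q4 := mul_rF (K := K) (Ne.symm hij) 1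
  have q5 := rhoF_mul_rhoF (K := K) hij (add_zero 0)
  have q6 := mul_rF (K := K) hij (-1)
  have q7 := rhoF_mul_rhoF (K := K) (Ne.symm hij) (add_neg_cancel 1)
  clear hS h1 h2 hy
  match_scalars
  all_goals grind

/-- The coordinates kill the vacuum and coefficients only get shifted, so the content is the passage
from y to ∂_{kγ} y. It splits according to which of i, j equal k, since only then do contractions
and sums over all indices appear. -/
theorem exchange (y : Fock K n N) : Exchange K n N y := by
  induction y using fock_induction with
  | one => intro i j α β; simp [fockX_one]
  | add y z hy hz =>
    intro i j α β
    simp only [map_add, hy i j α β, hz i j α β]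
    module
  | smul f y hy =>
    intro i j α β
    have h1 : ∀ a b : Fin n, (Pi.single a (-1) : Fin n → ℤ) + Pi.single b (-1) =
      Pi.single b (-1) + Pi.single a (-1) := fun a b => add_comm _ _
    simp only [fockX_smul, hy i j α β, shiftF_shiftF, h1 j i]
    module
  | deriv k γ y hy =>
    intro i j α β
    by_cases hki : k = i
    · subst hki
      by_cases hij : k = j
      · subst hij
        simpa using exchange_fockD_self k α β γ y hy
      · exact exchange_fockD_left hij α β γ y hy
    · by_cases hkj : k = j
      · subst hkj
        exact exchange_fockD_right (Ne.symm hki) α β γ y hy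
      · exact exchange_fockD_of_ne hki hkj α β γ y hy

end FockModule

/-! ### Defining relations in explicit form -/

section Relations

variable {K : Type*} [Field K] {n N : ℕ}

theorem x_mul_x (i j : Fin n) (α β : Fin N) :
    x K i α * x K j β = coeff K n N (rdiag K i j) * (x K i β * x K j α) +
      coeff K n N (rswap K i j) * (x K j β * x K i α) := by
  have := RingQuot.mkAlgHom_rel K (Rel.x_x (K := K) i j α β)
  simp only [map_mul, map_sum] at this
  refine this.trans ?_
  have h2 := sum_upper_Rhat K
    (fun k l f => coeff K n N f * (x K k β * x K l α)) (by simp) (by simp [add_mul]) i j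
  rw [← h2]
  simp only [← mul_assoc]
  rfl

theorem d_mul_d (k l : Fin n) (α β : Fin N) :
    d K l α * d K k β = d K l β * d K k α * coeff K n N (rdiag K k l) +
      d K k β * d K l α * coeff K n N (rswap K l k) := by
  have := RingQuot.mkAlgHom_rel K (Rel.d_d (K := K) k l α β)
  simp only [map_mul, map_sum] at this
  refine this.trans ?_
  have h2 := sum_lower_Rhat K
    (fun i j f => d K j β * d K i α * coeff K n N f) (by simp) (by simp [mul_add]) k l
  rw [← h2]
  rfl

theorem x_mul_d (i j : Fin n) (α β : Fin N) :
    x K i α * d K j β = d K j β * coeff K n N (rswap K j i) * x K i α +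
      (if i = j then ∑ k, d K k β * coeff K n N (rdiag K k i) * x K k α else 0) -
      if i = j ∧ α = β then 1 else 0 := by
  have := RingQuot.mkAlgHom_rel K (Rel.x_d (K := K) i j α β)
  simp only [map_mul, map_sum, map_sub] at this
  refine this.trans ?_
  have h2 := sum_mixed_Rhat K
    (fun k l f => d K k β * coeff K n N f * x K l α) (by simp) (by simp [mul_add, add_mul]) i j
  rw [← h2]
  congr 1
  split_ifs <;> simp

theorem coeff_h_mul_x (i j : Fin n) (α : Fin N) :
    coeff K n N (h K i) * x K j α = x K j α * coeff K n N (h K i + if i = j then 1 else 0) := by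
  have := RingQuot.mkAlgHom_rel K (Rel.weight_x (K := K) i j α)
  simp only [map_mul] at this
  exact this

theorem coeff_h_mul_d (i j : Fin n) (α : Fin N) :
    coeff K n N (h K i) * d K j α = d K j α * coeff K n N (h K i - if i = j then 1 else 0) := by
  have := RingQuot.mkAlgHom_rel K (Rel.weight_d (K := K) i j α)
  simp only [map_mul] at this
  exact this

/-- To move an element `y` past all coefficients it suffices to move it past the `hᵢ`. -/
theorem mul_coeff_of_h (y : Diff K n N) (c : Fin n → ℤ)
    (hy : ∀ i, y * coeff K n N (h K i) = coeff K n N (shift c (h K i)) * y) (f : Ubar K n) :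
    y * coeff K n N f = coeff K n N (shift c f) * y := by
  obtain ⟨p, q, rfl⟩ := IsLocalization.exists_mk'_eq (denominators K n) f
  have h1 : ∀ p : MvPolynomial (Fin n) K, y * coeff K n N (algebraMap _ _ p) =
      coeff K n N (shift c (algebraMap _ _ p)) * y := by
    intro p
    induction p using MvPolynomial.induction_on with
    | C a =>
      have h2 : algebraMap (MvPolynomial (Fin n) K) (Ubar K n) (C a) = algebraMap K _ a := rfl
      rw [h2]
      simp only [AlgHom.commutes]
      exact (Algebra.commutes _ _).symm
    | add p q hp hq => simp only [map_add, mul_add, add_mul, hp, hq]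
    | mul_X p i hp =>
      have h3 := hy i
      rw [h] at h3
      simp only [map_mul]
      rw [← mul_assoc, hp, mul_assoc, h3, ← mul_assoc]
  -- The polynomial case extends to fractions by cancelling the invertible denominator on the right.
  have h4 : IsUnit (coeff K n N (algebraMap _ (Ubar K n) (q : MvPolynomial (Fin n) K))) :=
    (IsLocalization.map_units (Ubar K n) q).map _
  apply h4.mul_left_injective
  dsimp only
  rw [mul_assoc, ← map_mul, IsLocalization.mk'_spec, h1, mul_assoc, h1, ← mul_assoc, ← map_mul,
    ← map_mul, IsLocalization.mk'_spec]

theorem x_mul_coeff (j : Fin n) (α : Fin N) (f : Ubar K n) :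
    x K j α * coeff K n N f = coeff K n N (shift (Pi.single j (-1)) f) * x K j α := by
  apply mul_coeff_of_h
  intro i
  have := coeff_h_mul_x (K := K) i j α
  by_cases hij : i = j
  · subst hij
    have h1 : shift (Pi.single i (-1)) (h K i) = h K i - 1 := by
      simp [sub_eq_add_neg]
    rw [h1, map_sub, map_one, sub_mul, this]
    simp [mul_add]
  · simp [hij] at this ⊢
    exact this.symm

theorem d_mul_coeff (j : Fin n) (α : Fin N) (f : Ubar K n) :
    d K j α * coeff K n N f = coeff K n N (shift (Pi.single j 1) f) * d K j α := by
  apply mul_coeff_of_h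
  intro i
  have := coeff_h_mul_d (K := K) i j α
  by_cases hij : i = j
  · subst hij
    simp [mul_sub, add_mul] at this ⊢
    rw [this]
    simp
  · simp [hij] at this ⊢
    exact this.symm

/-- An induction principle for the algebra `Diff K n N`. -/
theorem diff_induction {P : Diff K n N → Prop} (hc : ∀ f, P (coeff K n N f))
    (hx : ∀ i α, P (x K i α)) (hd : ∀ i α, P (d K i α)) (hadd : ∀ y z, P y → P z → P (y + z))
    (hmul : ∀ y z, P y → P z → P (y * z)) (y : Diff K n N) : P y := by
  obtain ⟨a, rfl⟩ := RingQuot.mkAlgHom_surjective K (Rel K n N) y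
  induction a using FreeAlgebra.induction with
  | grade0 c =>
    rw [AlgHom.commutes, ← AlgHom.commutes (coeff K n N)]
    exact hc _
  | grade1 g =>
    cases g with
    | coeff f => exact hc f
    | x i α => exact hx i α
    | d i α => exact hd i α
  | mul a b ha hb => rw [map_mul]; exact hmul _ _ ha hb
  | add a b ha hb => rw [map_add]; exact hadd _ _ ha hb

end Relations

/-! ### The Fock representation -/

section FockRepresentation

variable {K : Type*} [Field K] [CharZero K] {n N : ℕ}

/-- The operators on the Fock space corresponding to the generators of `Diff K n N`. -/
def fockGen : Gen K n N → Module.End K (Fock K n N)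
  | Gen.coeff f => fockSmul (algebraMap _ _ f)
  | Gen.x i α => fockX i α
  | Gen.d i α => fockD i α

/-- The action of `Diff K n N` on the Fock space. -/
def fockRep : Diff K n N →ₐ[K] Module.End K (Fock K n N) :=
  RingQuot.liftAlgHom K ⟨FreeAlgebra.lift K fockGen, by
    intro a b hab
    induction hab with
    | coeff_algebraMap c =>
      simp only [fc, FreeAlgebra.lift_ι_apply, AlgHom.commutes, fockGen]
      ext y
      simp [fockSmul_apply, ← IsScalarTower.algebraMap_apply]
    | coeff_add f g =>
      simp only [fc, FreeAlgebra.lift_ι_apply, map_add, fockGen]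
      ext y
      simp [fockSmul_apply, add_smul]
    | coeff_mul f g =>
      simp only [fc, FreeAlgebra.lift_ι_apply, map_mul, fockGen]
      ext y
      simp [fockSmul_apply, mul_smul]
    | weight_x i j α =>
      simp only [fc, fx, FreeAlgebra.lift_ι_apply, map_mul, fockGen]
      ext y
      have h1 : algebraMap (Ubar K n) (Fr K n) (h K i) = hF K i := rfl
      by_cases hij : i = j <;>
        simp [fockSmul_apply, fockX_smul, h1, hij]
    | weight_d i j α =>
      simp only [fc, fd, FreeAlgebra.lift_ι_apply, map_mul, fockGen]
      ext y
      have h1 : algebraMap (Ubar K n) (Fr K n) (h K i) = hF K i := rfl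
      by_cases hij : i = j <;>
        simp [fockSmul_apply, fockD_smul, h1, hij]
    | x_x i j α β =>
      simp only [fc, fx, FreeAlgebra.lift_ι_apply, map_mul, map_sum, fockGen]
      rw [sum_upper_Rhat K (fun k l f => fockSmul (algebraMap _ _ f) * fockX k β * fockX l α)]
      · ext y
        simpa [fockSmul_apply, algebraMap_rdiag, algebraMap_rswap] using exchange y i j α β
      · intro a b
        ext y
        simp [fockSmul_apply]
      · intro a b f f'
        ext y
        simp [fockSmul_apply, add_smul]
    | d_d k l α β =>
      simp only [fc, fd, FreeAlgebra.lift_ι_apply, map_mul, map_sum, fockGen]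
      rw [sum_lower_Rhat K (fun i j f => fockD j β * fockD i α * fockSmul (algebraMap _ _ f))]
      · ext y
        have h1 := fockD_fockD k l α β y
        by_cases hkl : k = l
        · subst hkl
          simpa [fockSmul_apply, algebraMap_rdiag, algebraMap_rswap] using h1
        · simpa [fockSmul_apply, algebraMap_rdiag, algebraMap_rswap, fockD_smul, hkl,
            Ne.symm hkl] using h1
      · intro a b
        ext y
        simp [fockSmul_apply]
      · intro a b f f'
        ext y
        simp [fockSmul_apply, add_smul]
    | x_d i j α β =>
      simp only [fc, fd, fx, FreeAlgebra.lift_ι_apply, map_mul, map_sum, fockGen, map_sub]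
      rw [sum_mixed_Rhat K (fun k l f => fockD k β * fockSmul (algebraMap _ _ f) * fockX l α)]
      · ext y
        by_cases hij : i = j
        · subst hij
          have h1 : ∀ α, ∑ m, rF K m i 1 • fockD m β (fockX m α y) =
              ∑ m, rF K m i (1 + -(Pi.single m 1 : Fin n → ℤ) i) • fockD m β (fockX m α y) := by
            intro α
            refine Finset.sum_congr rfl fun m _ => ?_
            by_cases hm : m = i
            · subst hm
              simp
            · simp [Ne.symm hm]
          by_cases hα : α = β <;>
            simp [fockSmul_apply, algebraMap_rdiag, fockX_fockD, fockD_smul, h1, contraction,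
              hα, sub_eq_add_neg, add_assoc]
        · simp [fockSmul_apply, algebraMap_rswap, fockX_fockD, fockD_smul, hij]
      · intro a b
        ext y
        simp [fockSmul_apply]
      · intro a b f f'
        ext y
        simp [fockSmul_apply, add_smul]⟩

@[simp]
theorem fockRep_coeff (f : Ubar K n) (y : Fock K n N) :
    fockRep (coeff K n N f) y = algebraMap (Ubar K n) (Fr K n) f • y := by
  change fockRep (RingQuot.mkAlgHom K (Rel K n N) (fc f)) y = _
  simp [fockRep, fc, fockGen, fockSmul_apply]

@[simp]
theorem fockRep_x (i : Fin n) (α : Fin N) (y : Fock K n N) :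
    fockRep (x K i α) y = fockX i α y := by
  simp [fockRep, x, fx, fockGen]

@[simp]
theorem fockRep_d (i : Fin n) (α : Fin N) (y : Fock K n N) :
    fockRep (d K i α) y = fockD i α y := by
  simp [fockRep, d, fd, fockGen]

variable (K n N) in
/-- The projection of the Fock space to its component of degree zero. -/
def fockAug : Fock K n N →ₐ[K] Fr K n :=
  RingQuot.liftAlgHom K ⟨FreeAlgebra.lift K fun g => match g with
    | FockGen.coeff f => f
    | FockGen.d _ _ => 0, by
    intro a b hab
    induction hab <;> simp [ffc, ffd]⟩

/-- The augmentation sending every derivative to 0 is a well-defined algebra map and recovers f from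
f • 1. -/
theorem smul_one_injective : Function.Injective fun f : Fr K n => f • (1 : Fock K n N) := by
  intro f g hfg
  have h1 : ∀ f : Fr K n, fockAug K n N (f • (1 : Fock K n N)) = f := by
    intro f
    rw [fock_smul_def, mul_one]
    change fockAug K n N (RingQuot.mkAlgHom K (FockRel K n N) (ffc f)) = f
    simp [fockAug, ffc]
  rw [← h1 f, ← h1 g]
  exact congrArg _ hfg

end FockRepresentation

/-! ### Weights, and quadratic elements of weight zero -/

section WeightZero

variable (K : Type*) [Field K] (n N : ℕ)

/-- The elements of the form `f + ∑ F_{iγδ} ∂_{iγ} x^{iδ}`. -/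
def weightZero : Submodule K (Diff K n N) where
  carrier := {z | ∃ (f : Ubar K n) (F : Fin n → Fin N → Fin N → Ubar K n),
    z = coeff K n N f + ∑ i, ∑ γ, ∑ δ, coeff K n N (F i γ δ) * (d K i γ * x K i δ)}
  zero_mem' := ⟨0, 0, by simp⟩
  add_mem' := by
    rintro _ _ ⟨f, F, rfl⟩ ⟨g, G, rfl⟩
    refine ⟨f + g, F + G, ?_⟩
    simp only [Pi.add_apply, map_add, add_mul, Finset.sum_add_distrib]
    abel
  smul_mem' := by
    rintro c _ ⟨f, F, rfl⟩
    refine ⟨c • f, c • F, ?_⟩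
    simp only [Pi.smul_apply, map_smul, smul_mul_assoc, smul_add, Finset.smul_sum]

/-- The commutator with a generic linear combination of the `hᵢ`. -/
def adH : Module.End K (Diff K n N) :=
  LinearMap.mulLeft K (coeff K n N (∑ i : Fin n, (((i : ℕ) + 1 : ℕ) : Ubar K n) * h K i)) -
    LinearMap.mulRight K (coeff K n N (∑ i : Fin n, (((i : ℕ) + 1 : ℕ) : Ubar K n) * h K i))

variable {K n N}

theorem coeff_mem_weightZero (f : Ubar K n) : coeff K n N f ∈ weightZero K n N :=
  ⟨f, 0, by simp⟩

theorem coeff_mul_d_mul_x_mem_weightZero (f : Ubar K n) (i : Fin n) (γ δ : Fin N) :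
    coeff K n N f * (d K i γ * x K i δ) ∈ weightZero K n N := by
  refine ⟨0, fun a b c => if a = i then if b = γ then if c = δ then f else 0 else 0 else 0, ?_⟩
  rw [map_zero, zero_add, Finset.sum_eq_single i, Finset.sum_eq_single γ,
    Finset.sum_eq_single δ] <;> simp +contextual

theorem coeff_mul_x_mul_d_mem_weightZero (f : Ubar K n) (i : Fin n) (γ δ : Fin N) :
    coeff K n N f * (x K i γ * d K i δ) ∈ weightZero K n N := by
  rw [x_mul_d, if_pos rfl]
  simp only [mul_sub, mul_add, Finset.mul_sum]
  refine Submodule.sub_mem _ (Submodule.add_mem _ ?_ (Submodule.sum_mem _ fun k _ => ?_)) ?_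
  · simpa using coeff_mul_d_mul_x_mem_weightZero f i δ γ
  · rw [d_mul_coeff, mul_assoc, ← mul_assoc, ← map_mul]
    exact coeff_mul_d_mul_x_mem_weightZero _ _ _ _
  · split_ifs
    · simpa using coeff_mem_weightZero f
    · simp

theorem adH_apply (y : Diff K n N) : adH K n N y =
    coeff K n N (∑ i : Fin n, (((i : ℕ) + 1 : ℕ) : Ubar K n) * h K i) * y -
      y * coeff K n N (∑ i : Fin n, (((i : ℕ) + 1 : ℕ) : Ubar K n) * h K i) := rfl

theorem commutator_mul {R : Type*} [Ring R] (a y z : R) :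
    a * (y * z) - y * z * a = (a * y - y * a) * z + y * (a * z - z * a) := by
  noncomm_ring

theorem sub_add_smul_eq {M : Type*} [AddCommGroup M] [Module K M] (y z : M) (c c' : K)
    (hc : c' = -c) : y - (y + c • z) = c' • z := by
  subst hc
  module

theorem adH_mul {y z : Diff K n N} {μ ν : K} (hy : adH K n N y = μ • y)
    (hz : adH K n N z = ν • z) : adH K n N (y * z) = (μ + ν) • (y * z) := by
  rw [adH_apply] at hy hz ⊢
  rw [add_smul, ← smul_mul_assoc, ← mul_smul_comm, ← hy, ← hz]
  exact commutator_mul _ _ _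

theorem adH_coeff (f : Ubar K n) : adH K n N (coeff K n N f) = (0 : K) • coeff K n N f := by
  rw [adH_apply, ← map_mul, ← map_mul, mul_comm, sub_self, zero_smul]

theorem shift_generic (j : Fin n) (c : ℤ) :
    shift (Pi.single j c) (∑ i : Fin n, (((i : ℕ) + 1 : ℕ) : Ubar K n) * h K i) =
      (∑ i : Fin n, (((i : ℕ) + 1 : ℕ) : Ubar K n) * h K i) +
        algebraMap K _ (((j : ℕ) + 1 : ℕ) * (c : K)) := by
  simp only [map_sum, map_mul, map_natCast, shift_h, mul_add, Finset.sum_add_distrib, map_intCast]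
  congr 1
  rw [Finset.sum_eq_single j] <;> simp +contextual

theorem adH_x (i : Fin n) (α : Fin N) :
    adH K n N (x K i α) = (((i : ℕ) + 1 : ℕ) : K) • x K i α := by
  rw [adH_apply, x_mul_coeff, shift_generic, map_add, AlgHom.commutes, add_mul,
    ← Algebra.smul_def]
  refine sub_add_smul_eq (K := K) (M := Diff K n N) _ _ _ _ ?_
  push_cast
  ring

theorem adH_d (i : Fin n) (α : Fin N) :
    adH K n N (d K i α) = (-(((i : ℕ) + 1 : ℕ) : K)) • d K i α := by
  rw [adH_apply, d_mul_coeff, shift_generic, map_add, AlgHom.commutes, add_mul,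
    ← Algebra.smul_def]
  refine sub_add_smul_eq (K := K) (M := Diff K n N) _ _ _ _ ?_
  push_cast
  ring

theorem weightZero_le : weightZero K n N ≤ (adH K n N).eigenspace 0 := by
  rintro _ ⟨f, F, rfl⟩
  refine Submodule.add_mem _ ?_ (Submodule.sum_mem _ fun i _ => Submodule.sum_mem _ fun γ _ =>
    Submodule.sum_mem _ fun δ _ => ?_)
  · rw [Module.End.mem_eigenspace_iff, adH_coeff]
  · rw [Module.End.mem_eigenspace_iff, adH_mul (adH_coeff _) (adH_mul (adH_d _ _) (adH_x _ _))]
    simp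

variable [CharZero K]

/-- The generators are eigenvectors of `adH` with eigenvalues ±(i + 1). In characteristic zero these
numbers are distinct and nonzero, and sums of two of the same sign are nonzero. So a word of length
at most two has weight zero only if it is empty or pairs x^{iα} with ∂_{iβ} for the same i. -/
theorem degLE_two_le :
    degLE K n N 2 ≤ weightZero K n N ⊔ ⨆ (μ : K) (_ : μ ≠ 0), (adH K n N).eigenspace μ := by
  have key : ∀ (y : Diff K n N) (μ : K), μ ≠ 0 → adH K n N y = μ • y → ∀ f,
      coeff K n N f * y ∈
        weightZero K n N ⊔ ⨆ (μ : K) (_ : μ ≠ 0), (adH K n N).eigenspace μ := by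
    intro y μ hμ hy f
    apply Submodule.mem_sup_right
    apply Submodule.mem_iSup_of_mem μ
    apply Submodule.mem_iSup_of_mem hμ
    rw [Module.End.mem_eigenspace_iff, adH_mul (adH_coeff f) hy, zero_add]
  have hpos : ∀ i : ℕ, ((i + 1 : ℕ) : K) ≠ 0 := fun i => Nat.cast_ne_zero.mpr i.succ_ne_zero
  have hpos2 : ∀ i j : ℕ, ((i + 1 : ℕ) : K) + ((j + 1 : ℕ) : K) ≠ 0 := fun i j => by
    rw [← Nat.cast_add]
    exact Nat.cast_ne_zero.mpr (by omega)
  have hne : ∀ i j : Fin n, i ≠ j → (((i : ℕ) + 1 : ℕ) : K) ≠ (((j : ℕ) + 1 : ℕ) : K) :=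
    fun i j hij hc => hij (by
      ext
      have := Nat.cast_injective hc
      omega)
  apply Submodule.span_le.mpr
  rintro _ ⟨f, w, hw, hgen, rfl⟩
  rw [SetLike.mem_coe]
  match w, hw, hgen with
  | [], _, _ =>
    apply Submodule.mem_sup_left
    simpa using coeff_mem_weightZero f
  | [y], _, hgen =>
    obtain ⟨i, α, rfl | rfl⟩ := hgen y (by simp)
    · rw [List.prod_singleton]
      exact key _ _ (hpos i) (adH_x i α) f
    · rw [List.prod_singleton]
      exact key _ _ (neg_ne_zero.mpr (hpos i)) (adH_d i α) f
  | [y, z], _, hgen =>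
    have hp : [y, z].prod = y * z := by simp
    rw [hp]
    obtain ⟨i, α, rfl | rfl⟩ := hgen y (by simp) <;> obtain ⟨j, β, rfl | rfl⟩ := hgen z (by simp)
    · exact key _ _ (hpos2 i j) (adH_mul (adH_x i α) (adH_x j β)) f
    · by_cases hij : i = j
      · subst hij
        exact Submodule.mem_sup_left (coeff_mul_x_mul_d_mem_weightZero f i α β)
      · refine key _ _ ?_ (adH_mul (adH_x i α) (adH_d j β)) f
        rw [← sub_eq_add_neg]
        exact sub_ne_zero.mpr (hne i j hij)
    · by_cases hij : i = j
      · subst hij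
        exact Submodule.mem_sup_left (coeff_mul_d_mul_x_mem_weightZero f i α β)
      · refine key _ _ ?_ (adH_mul (adH_d i α) (adH_x j β)) f
        rw [neg_add_eq_sub]
        exact sub_ne_zero.mpr (hne j i (Ne.symm hij))
    · refine key _ _ ?_ (adH_mul (adH_d i α) (adH_d j β)) f
      rw [← neg_add]
      exact neg_ne_zero.mpr (hpos2 i j)

/-- A central element lies in the zero eigenspace of `adH`, which is independent of the nonzero
ones; its part of nonzero weight therefore vanishes. -/
theorem quadCentral_le_weightZero : quadCentral K n N ≤ weightZero K n N := by
  rintro z ⟨hz, hc⟩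
  obtain ⟨s, hs, t, ht, rfl⟩ := Submodule.mem_sup.mp (degLE_two_le hz)
  have hz0 : s + t ∈ (adH K n N).eigenspace 0 := by
    rw [Module.End.mem_eigenspace_iff, adH_apply, zero_smul, sub_eq_zero]
    exact (Subalgebra.mem_center_iff (R := K)).mp hc _
  have ht0 : t ∈ (adH K n N).eigenspace 0 := by
    have := Submodule.sub_mem _ hz0 (weightZero_le hs)
    simpa using this
  have := (Submodule.disjoint_def.mp ((adH K n N).eigenspaces_iSupIndep 0)) t ht0 ht
  rw [this, add_zero]
  exact hs

end WeightZero

/-! ### Necessary conditions from commutation with derivatives -/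

section CentralForm

variable {K : Type*} [Field K] {n N : ℕ}

/-- The difference operator in the direction `i`. -/
def diffOp (i : Fin n) : Ubar K n →ₗ[K] Ubar K n :=
  (shift (Pi.single i 1)).toLinearMap - LinearMap.id

theorem diffOp_apply (i : Fin n) (f : Ubar K n) : diffOp i f = shift (Pi.single i 1) f - f := rfl

variable (K N) in
/-- The element `∑_α ∂_{iα} x^{iα}`. -/
def euler (i : Fin n) : Diff K n N := ∑ α, d K i α * x K i α

variable [CharZero K]

theorem fockX_fockD_one (i j : Fin n) (γ β : Fin N) :
    fockX i γ (fockD j β (1 : Fock K n N)) = if i = j then contraction K n γ β • 1 else 0 := by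
  simp [fockX_fockD, fockX_one]

theorem fockX_fockD_fockD_one (i k l : Fin n) (γ α β : Fin N) :
    fockX i γ (fockD l α (fockD k β (1 : Fock K n N))) =
      (if i = k then (rhoF K l i 1 * contraction K n γ β) • fockD l α 1 else 0) +
      if i = l then (rF K k l 1 * contraction K n γ β) • fockD k α 1 +
        contraction K n γ α • fockD k β 1 else 0 := by
  rw [fockX_fockD]
  congr 1
  · rw [fockX_fockD_one]
    split_ifs <;> simp [fockD_smul, mul_smul]
  · congr 2
    rw [Finset.sum_eq_single k]
    · simp [fockX_fockD_one, fockD_smul, mul_smul]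
    · intro b _ hb
      simp [fockX_fockD_one, hb]
    · simp

theorem fockRep_euler_fockD_fockD_one (i k l : Fin n) (α β : Fin N) :
    fockRep (euler K N i) (fockD l α (fockD k β (1 : Fock K n N))) =
      (if i = k then -(fockD l α (fockD k β 1) - rF K k l 0 • fockD l β (fockD k α 1)) else 0) -
      if i = l then rF K k l 0 • fockD l β (fockD k α 1) + fockD l α (fockD k β 1) else 0 := by
  have hs : ∀ (γ : Fin N) (y : Fin N → Fock K n N),
      ∑ δ, contraction K n δ γ • y δ = (-1 : Fr K n) • y γ := by
    intro γ y
    rw [Finset.sum_eq_single γ] <;> simp +contextual [contraction]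
  have h1 := fockD_fockD k l α β (1 : Fock K n N)
  simp only [euler, map_sum, map_mul, Module.End.mul_apply, LinearMap.sum_apply, fockRep_d,
    fockRep_x, fockX_fockD_fockD_one, map_add, Finset.sum_add_distrib]
  rw [sub_eq_add_neg]
  congr 1
  · by_cases hik : i = k
    · subst hik
      simp only [if_true, mul_comm _ (contraction K n _ _), mul_smul, fockD_smul,
        shiftF_contraction, hs, shiftF_rhoF]
      rw [h1]
      by_cases hil : i = l
      · subst hil
        simp
      · simp [Ne.symm hil]
    · simp [hik]
  · by_cases hil : i = l
    · subst hil
      simp only [if_true, mul_comm _ (contraction K n _ _), mul_smul, fockD_smul, map_add,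
        shiftF_contraction, Finset.sum_add_distrib, hs, shiftF_rF]
      by_cases hik : k = i
      · subst hik
        simp
      · simp [hik]
        exact add_comm _ _
    · simp [hil]

/-- If it vanished, then with u = h_i - h_j + c one would get u² - 1 = (u + 1)(u - 1) = 0, although
both factors are nonzero. -/
theorem rhoF_ne_zero {i j : Fin n} (hij : i ≠ j) (c : ℤ) : rhoF K i j c ≠ 0 := by
  intro h0
  have h1 := rhoF_mul_rhoF (K := K) hij (add_neg_cancel c)
  have h2 := hF_sub_add_ne_zero K hij (c + 1)
  have h3 := hF_sub_add_ne_zero K hij (c - 1)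
  push_cast at h2 h3
  rw [h0] at h1
  exact mul_ne_zero h2 h3 (by linear_combination -h1)

theorem smul_fockD_one_eq_zero {f : Fr K n} {i : Fin n} {α : Fin N}
    (hf : f • fockD i α (1 : Fock K n N) = 0) : f = 0 := by
  have h1 := congrArg (fockX i α) hf
  rw [fockX_smul, fockX_fockD_one, if_pos rfl, map_zero, smul_smul] at h1
  have h2 := smul_one_injective (h1.trans (zero_smul (Fr K n) (1 : Fock K n N)).symm)
  simpa [contraction] using h2

/-- Applying x^{kβ} contracts the left side with ∂_{kβ}, while the right side could only be
contracted with ∂_{kα}, which gives zero for α ≠ β. The alternative g = 0 covers a single copy. -/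
theorem smul_fockD_fockD_one_eq_zero {f g : Fr K n} {k l : Fin n} (hkl : k ≠ l) {α β : Fin N}
    (hf : f • fockD l α (fockD k β (1 : Fock K n N)) =
      g • fockD l β (fockD k α (1 : Fock K n N))) (hα : α ≠ β ∨ g = 0) : f = 0 := by
  have h1 := congrArg (fockX k β) hf
  rw [fockX_smul, fockX_smul, fockX_fockD_fockD_one, fockX_fockD_fockD_one] at h1
  have h2 : shiftF (Pi.single k (-1)) g • contraction K n β α = 0 := by
    rcases hα with hα | rfl
    · simp [contraction, Ne.symm hα]
    · simp
  rw [if_pos rfl, if_pos rfl, if_neg hkl, if_neg hkl, add_zero, add_zero, smul_smul, smul_smul,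
    mul_left_comm _ _ (contraction K n β α), ← smul_eq_mul _ (contraction K n β α), h2, mul_zero,
    zero_smul] at h1
  have h3 := smul_fockD_one_eq_zero h1
  have h4 := rhoF_ne_zero (K := K) (Ne.symm hkl) 1
  simpa [contraction, h4] using h3

/-- Here x^{kα} contracts with either factor; the contributions add up to -2, which is nonzero in
characteristic zero. -/
theorem smul_fockD_fockD_self_one_eq_zero {f : Fr K n} {k : Fin n} {α : Fin N}
    (hf : f • fockD k α (fockD k α (1 : Fock K n N)) = 0) : f = 0 := by
  have h1 := congrArg (fockX k α) hf
  rw [fockX_smul, fockX_fockD_fockD_one, map_zero, if_pos rfl, if_pos rfl, rhoF_self, rF_self,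
    zero_mul, zero_smul, zero_add, one_mul, ← add_smul, smul_smul] at h1
  have h3 := smul_fockD_one_eq_zero h1
  have h4 : (-1 + -1 : Fr K n) ≠ 0 := by
    have : CharZero (Fr K n) := charZero_of_injective_algebraMap (algebraMap K (Fr K n)).injective
    norm_num
  simpa [contraction, h4] using h3

theorem fockRep_commute {z : Diff K n N} (hz : z ∈ Subalgebra.center K (Diff K n N))
    (j : Fin n) (β : Fin N) (y : Fock K n N) :
    fockRep z (fockD j β y) = fockD j β (fockRep z y) := by
  have h1 := (Subalgebra.mem_center_iff (R := K)).mp hz (d K j β)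
  have h2 := congrArg (fun t => fockRep t y) h1
  simp only [map_mul, Module.End.mul_apply, fockRep_d] at h2
  exact h2.symm

/-- On the vacuum z acts as f. Comparing z ∂_{jβ} 1 with ∂_{jβ} z 1, whose coefficient is the
shifted f, leaves the F_{jγβ} as the coefficients of ∂_{jγ} 1, and x^{jγ} extracts them one at a
time. -/
theorem quadCentral_eq {z : Diff K n N} (hz : z ∈ quadCentral K n N) :
    ∃ f : Ubar K n, z = coeff K n N f - ∑ i, coeff K n N (diffOp i f) * euler K N i := by
  obtain ⟨f, F, hF⟩ := quadCentral_le_weightZero hz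
  refine ⟨f, ?_⟩
  have h1 : ∀ y, fockRep z y = algebraMap _ (Fr K n) f • y +
      ∑ i, ∑ γ, ∑ δ, algebraMap _ (Fr K n) (F i γ δ) • fockD i γ (fockX i δ y) := by
    intro y
    rw [hF]
    simp [LinearMap.sum_apply]
  have h2 : ∀ j γ β, F j γ β = if γ = β then - diffOp j f else 0 := by
    intro j γ β
    have h3 := fockRep_commute hz.2 j β 1
    rw [h1, h1] at h3
    simp only [fockX_one, map_zero, smul_zero, Finset.sum_const_zero, add_zero, fockD_smul,
      fockX_fockD_one] at h3
    have h4 : ∑ i, ∑ γ, ∑ δ, algebraMap _ (Fr K n) (F i γ δ) • fockD i γ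
        (if i = j then contraction K n δ β • (1 : Fock K n N) else 0) =
        ∑ γ, (-algebraMap _ (Fr K n) (F j γ β)) • fockD j γ (1 : Fock K n N) := by
      rw [Finset.sum_eq_single j]
      · refine Finset.sum_congr rfl fun γ _ => ?_
        rw [Finset.sum_eq_single β]
        · simp [contraction]
        · intro b _ hb
          simp [contraction, hb]
        · simp
      · intro b _ hb
        simp [hb]
      · simp
    rw [h4] at h3
    have h5 := congrArg (fockX j γ) h3
    rw [map_add, map_sum, Finset.sum_eq_single γ] at h5
    · rw [fockX_smul, fockX_smul, fockX_smul, fockX_fockD_one, if_pos rfl, fockX_fockD_one,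
        if_pos rfl, smul_smul, smul_smul, smul_smul, ← add_smul] at h5
      have h6 := smul_one_injective h5
      by_cases hγ : γ = β
      · subst hγ
        simp [contraction] at h6
        rw [if_pos rfl]
        -- Passing x^{jγ} through the coefficients has shifted all of them by -1 in h_j, so the
        -- comparison is made after the same shift.
        apply shift_injective (Pi.single j (-1))
        rw [map_neg, diffOp_apply, map_sub, shift_shift]
        apply IsFractionRing.injective (Ubar K n) (Fr K n)
        rw [map_neg, map_sub]
        linear_combination h6
      · simp [contraction, hγ] at h6
        rw [if_neg hγ]
        apply shift_injective (Pi.single j (-1))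
        rw [map_zero]
        exact h6
    · intro b _ hb
      rw [fockX_smul, fockX_fockD_one]
      simp [contraction, Ne.symm hb]
    · simp
  rw [hF, sub_eq_add_neg, ← Finset.sum_neg_distrib]
  congr 1
  refine Finset.sum_congr rfl fun i _ => ?_
  rw [euler, Finset.mul_sum, ← Finset.sum_neg_distrib]
  refine Finset.sum_congr rfl fun γ _ => ?_
  rw [Finset.sum_eq_single γ]
  · rw [h2, if_pos rfl, map_neg]
    exact neg_mul (α := Diff K n N) _ _
  · intro b _ hb
    simp [h2, Ne.symm hb]
  · simp

/-- Since z is central, z ∂∂1 = ∂∂ z 1, so f comes out shifted in both variables. In its expansion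
into differences the first-order terms are absorbed by the E_i, up to the exchange of copies that
produces the right side. -/
theorem diffOp_relation {f : Ubar K n}
    (hz : coeff K n N f - ∑ i, coeff K n N (diffOp i f) * euler K N i ∈ quadCentral K n N)
    (k l : Fin n) (α β : Fin N) :
    algebraMap _ (Fr K n) (diffOp l (diffOp k f)) • fockD l α (fockD k β (1 : Fock K n N)) =
      (rF K k l 0 * (algebraMap _ (Fr K n) (diffOp l f) - algebraMap _ (Fr K n) (diffOp k f))) •
        fockD l β (fockD k α (1 : Fock K n N)) := by
  have h1 := fockRep_commute hz.2 l α (fockD k β 1)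
  rw [fockRep_commute hz.2 k β 1] at h1
  have h2 : ∀ y, fockRep (coeff K n N f - ∑ i, coeff K n N (diffOp i f) * euler K N i) y =
      algebraMap _ (Fr K n) f • y -
        ∑ i, algebraMap _ (Fr K n) (diffOp i f) • fockRep (euler K N i) y := by
    intro y
    simp [LinearMap.sum_apply]
  have h3 : ∀ i, fockRep (euler K N i) (1 : Fock K n N) = 0 := by
    intro i
    simp [euler, LinearMap.sum_apply, fockX_one]
  rw [h2, h2] at h1
  simp only [h3, smul_zero, Finset.sum_const_zero, sub_zero, fockD_smul,
    fockRep_euler_fockD_fockD_one, smul_sub, Finset.sum_sub_distrib, smul_ite,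
    Finset.sum_ite_eq', Finset.mem_univ, if_true, shiftF_algebraMap] at h1
  have h4 : shift (Pi.single l 1) (shift (Pi.single k 1) f) =
      f + diffOp k f + diffOp l f + diffOp l (diffOp k f) := by
    simp only [diffOp_apply, map_sub]
    ring
  rw [h4] at h1
  simp only [map_add] at h1
  linear_combination (norm := module) -h1

theorem diffOp_diffOp_self {f : Ubar K n} (hN : 0 < N)
    (hz : coeff K n N f - ∑ i, coeff K n N (diffOp i f) * euler K N i ∈ quadCentral K n N)
    (k : Fin n) : diffOp k (diffOp k f) = 0 := by
  have h1 := diffOp_relation hz k k ⟨0, hN⟩ ⟨0, hN⟩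
  rw [rF_self, zero_mul, zero_smul] at h1
  apply IsFractionRing.injective (Ubar K n) (Fr K n)
  rw [smul_fockD_fockD_self_one_eq_zero h1, map_zero]

theorem diffOp_diffOp {f : Ubar K n} (hN : 0 < N)
    (hz : coeff K n N f - ∑ i, coeff K n N (diffOp i f) * euler K N i ∈ quadCentral K n N)
    (k l : Fin n) : (h K k - h K l) * diffOp l (diffOp k f) = diffOp l f - diffOp k f := by
  by_cases hkl : k = l
  · subst hkl
    simp
  have h1 := diffOp_relation hz k l ⟨0, hN⟩ ⟨0, hN⟩
  rw [← sub_eq_zero, ← sub_smul] at h1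
  have h2 := smul_fockD_fockD_one_eq_zero (g := 0) hkl (h1.trans (zero_smul _ _).symm) (Or.inr rfl)
  apply IsFractionRing.injective (Ubar K n) (Fr K n)
  have h3 := mul_rF (K := K) hkl 0
  have h4 : algebraMap (Ubar K n) (Fr K n) (h K k - h K l) = hF K k - hF K l := map_sub _ _ _
  rw [map_mul, h4, map_sub]
  rw [Int.cast_zero, add_zero] at h3
  linear_combination (hF K k - hF K l) * h2 +
    (algebraMap _ (Fr K n) (diffOp l f) - algebraMap _ (Fr K n) (diffOp k f)) * h3

/-- Two distinct copies are available, so the two vectors in `diffOp_relation` are independent and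
each coefficient vanishes separately; `rF K k l 0` is nonzero for k ≠ l. -/
theorem diffOp_eq_diffOp {f : Ubar K n} (hN : 1 < N)
    (hz : coeff K n N f - ∑ i, coeff K n N (diffOp i f) * euler K N i ∈ quadCentral K n N)
    (k l : Fin n) : diffOp l f = diffOp k f := by
  by_cases hkl : k = l
  · subst hkl
    rfl
  have h1 := diffOp_relation hz k l ⟨0, by omega⟩ ⟨1, hN⟩
  have h2 := smul_fockD_fockD_one_eq_zero hkl h1.symm (Or.inl (by simp))
  apply IsFractionRing.injective (Ubar K n) (Fr K n)
  rw [mul_eq_zero, sub_eq_zero] at h2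
  refine h2.resolve_left fun h3 => ?_
  have h4 := mul_rF (K := K) hkl 0
  simp [h3] at h4

end CentralForm

/-! ### The difference equations and elementary symmetric polynomials -/

section DifferenceEquations

variable {K : Type*} [Field K] {n : ℕ}

variable (K) in
/-- The polynomial `∏_{j ∈ s} (X + h_j)`; its coefficients are the elementary symmetric polynomials
in the `h_j` with `j ∈ s`. -/
def esymmPoly (s : Finset (Fin n)) : Polynomial (Ubar K n) :=
  ∏ j ∈ s, (Polynomial.X + Polynomial.C (h K j))

theorem esymmPoly_eq_mul {s : Finset (Fin n)} {k : Fin n} (hk : k ∈ s) :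
    esymmPoly K s = (Polynomial.X + Polynomial.C (h K k)) * esymmPoly K (s.erase k) :=
  (Finset.mul_prod_erase s _ hk).symm

theorem coeff_esymmPoly_card (s : Finset (Fin n)) : (esymmPoly K s).coeff s.card = 1 := by
  have h1 := Polynomial.coeff_prod_of_natDegree_le
    (s := s) (fun j => Polynomial.X + Polynomial.C (h K j)) 1
    (fun j _ => Polynomial.natDegree_add_C.trans_le Polynomial.natDegree_X_le)
  rw [mul_one] at h1
  rw [esymmPoly, h1]
  simp

theorem coeff_esymmPoly_of_card_lt {s : Finset (Fin n)} {r : ℕ} (hr : s.card < r) :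
    (esymmPoly K s).coeff r = 0 := by
  refine Polynomial.coeff_eq_zero_of_natDegree_lt (lt_of_le_of_lt ?_ hr)
  refine (Polynomial.natDegree_prod_le _ _).trans ?_
  refine (Finset.sum_le_card_nsmul s _ 1 fun j _ =>
    Polynomial.natDegree_add_C.trans_le Polynomial.natDegree_X_le).trans ?_
  simp

theorem map_shift_esymmPoly_of_notMem {s : Finset (Fin n)} {k : Fin n} (hk : k ∉ s) :
    (esymmPoly K s).map (shift (K := K) (Pi.single k 1)).toRingHom = esymmPoly K s := by
  rw [esymmPoly, Polynomial.map_prod]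
  refine Finset.prod_congr rfl fun j hj => ?_
  have h1 : j ≠ k := fun h => hk (h ▸ hj)
  simp [h1]

theorem diffOp_coeff_esymmPoly_of_notMem {s : Finset (Fin n)} {k : Fin n} (hk : k ∉ s) (r : ℕ) :
    diffOp k ((esymmPoly K s).coeff r) = 0 := by
  have h1 := congrArg (fun p => Polynomial.coeff p r) (map_shift_esymmPoly_of_notMem (K := K) hk)
  simp only [Polynomial.coeff_map] at h1
  rw [diffOp_apply, sub_eq_zero]
  exact h1

/-- The shift replaces the factor X + h_k by X + h_k + 1, so the difference is the product with that
factor deleted. -/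
theorem diffOp_coeff_esymmPoly {s : Finset (Fin n)} {k : Fin n} (hk : k ∈ s) (r : ℕ) :
    diffOp k ((esymmPoly K s).coeff r) = (esymmPoly K (s.erase k)).coeff r := by
  have h1 : (esymmPoly K s).map (shift (K := K) (Pi.single k 1)).toRingHom =
      esymmPoly K s + esymmPoly K (s.erase k) := by
    rw [esymmPoly_eq_mul hk, Polynomial.map_mul,
      map_shift_esymmPoly_of_notMem (Finset.notMem_erase k s)]
    simp
    ring
  have h2 := congrArg (fun p => Polynomial.coeff p r) h1
  simp only [Polynomial.coeff_map, Polynomial.coeff_add] at h2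
  rw [diffOp_apply, sub_eq_iff_eq_add']
  exact h2

theorem diffOp_comm (k l : Fin n) (f : Ubar K n) :
    diffOp k (diffOp l f) = diffOp l (diffOp k f) := by
  simp only [diffOp_apply, map_sub, shift_shift, add_comm (Pi.single k 1 : Fin n → ℤ)]
  ring

theorem diffOp_sub_mul {k l m : Fin n} (hkl : l ≠ k) (hkm : m ≠ k) (f : Ubar K n) :
    diffOp k ((h K l - h K m) * f) = (h K l - h K m) * diffOp k f := by
  simp [diffOp_apply, hkl, hkm, mul_sub]

variable (K) in
/-- The solutions of the system of difference equations satisfied by the coefficients of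
`esymmPoly K s`. -/
def esymmSolutions (s : Finset (Fin n)) : Submodule K (Ubar K n) where
  carrier := {f | (∀ k ∉ s, diffOp k f = 0) ∧ (∀ k, diffOp k (diffOp k f) = 0) ∧
    ∀ k ∈ s, ∀ l ∈ s, (h K k - h K l) * diffOp l (diffOp k f) = diffOp l f - diffOp k f}
  zero_mem' := by simp
  add_mem' := by
    rintro a b ⟨ha1, ha2, ha3⟩ ⟨hb1, hb2, hb3⟩
    refine ⟨fun k hk => ?_, fun k => ?_, fun k hk l hl => ?_⟩
    · rw [map_add, ha1 k hk, hb1 k hk, add_zero]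
    · rw [map_add, map_add, ha2, hb2, add_zero]
    · simp only [map_add]
      linear_combination ha3 k hk l hl + hb3 k hk l hl
  smul_mem' := by
    rintro c a ⟨ha1, ha2, ha3⟩
    refine ⟨fun k hk => ?_, fun k => ?_, fun k hk l hl => ?_⟩
    · rw [map_smul, ha1 k hk, smul_zero]
    · rw [map_smul, map_smul, ha2, smul_zero]
    · simp only [map_smul]
      rw [mul_smul_comm, ha3 k hk l hl, smul_sub]

/-- With P the product over s without k and l, the mixed equation is the r-th coefficient of (h_k -
h_l) P = (X + h_k) P - (X + h_l) P. -/
theorem coeff_esymmPoly_mem_esymmSolutions (s : Finset (Fin n)) (r : ℕ) :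
    (esymmPoly K s).coeff r ∈ esymmSolutions K s := by
  refine ⟨fun k hk => diffOp_coeff_esymmPoly_of_notMem hk r, fun k => ?_, fun k hk l hl => ?_⟩
  · by_cases hk : k ∈ s
    · rw [diffOp_coeff_esymmPoly hk, diffOp_coeff_esymmPoly_of_notMem (Finset.notMem_erase k s)]
    · rw [diffOp_coeff_esymmPoly_of_notMem hk, map_zero]
  · by_cases hkl : k = l
    · subst hkl
      simp
    have h1 : l ∈ s.erase k := Finset.mem_erase.mpr ⟨Ne.symm hkl, hl⟩
    have h2 : k ∈ s.erase l := Finset.mem_erase.mpr ⟨hkl, hk⟩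
    rw [diffOp_coeff_esymmPoly hk, diffOp_coeff_esymmPoly hl, diffOp_coeff_esymmPoly h1,
      ← Polynomial.coeff_sub, ← Polynomial.coeff_C_mul, esymmPoly_eq_mul h1, esymmPoly_eq_mul h2,
      Finset.erase_right_comm]
    congr 1
    rw [Polynomial.C_sub]
    ring

variable [CharZero K]

theorem eq_algebraMap_of_diffOp {f : Ubar K n} (hf : ∀ k, diffOp k f = 0) :
    ∃ c : K, f = algebraMap K _ c :=
  eq_algebraMap_of_shift f fun k => sub_eq_zero.mp (hf k)

/-- Δ_k sends solutions for `insert k s` to solutions for s, and each coefficient of `esymmPoly K s`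
is Δ_k of the corresponding coefficient for `insert k s`. Hence some combination g of the latter
satisfies Δ_k(f - g) = 0. The mixed equation for k and l then kills every other difference of f - g,
which is a constant, that is, a multiple of the top coefficient 1. -/
theorem esymmSolutions_le (s : Finset (Fin n)) :
    esymmSolutions K s ≤ Submodule.span K (Set.range fun r => (esymmPoly K s).coeff r) := by
  induction s using Finset.induction_on with
  | empty =>
    rintro f ⟨hf, -, -⟩
    obtain ⟨c, rfl⟩ := eq_algebraMap_of_diffOp fun k => hf k (Finset.notMem_empty k)
    rw [Algebra.algebraMap_eq_smul_one, ← coeff_esymmPoly_card ∅]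
    exact Submodule.smul_mem _ _ (Submodule.subset_span ⟨_, rfl⟩)
  | insert k s hk ih =>
    intro f hf
    have h1 : diffOp k f ∈ esymmSolutions K s := by
      obtain ⟨h1, h2, h3⟩ := hf
      refine ⟨fun l hl => ?_, fun l => ?_, fun l hl m hm => ?_⟩
      · by_cases hlk : l = k
        · rw [hlk, h2]
        · rw [diffOp_comm, h1 l (by simp [hlk, hl]), map_zero]
      · rw [diffOp_comm l k, diffOp_comm l k, h2, map_zero]
      · have hlk : l ≠ k := fun h => hk (h ▸ hl)
        have hmk : m ≠ k := fun h => hk (h ▸ hm)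
        have h4 := congrArg (diffOp k)
          (h3 l (Finset.mem_insert_of_mem hl) m (Finset.mem_insert_of_mem hm))
        rw [diffOp_sub_mul hlk hmk, map_sub] at h4
        rw [diffOp_comm l k, diffOp_comm m k, diffOp_comm m k, h4]
    have h2 : Submodule.span K (Set.range fun r => (esymmPoly K s).coeff r) ≤
        (Submodule.span K (Set.range fun r => (esymmPoly K (insert k s)).coeff r) ⊓
          esymmSolutions K (insert k s)).map (diffOp k) := by
      rw [Submodule.span_le]
      rintro _ ⟨r, rfl⟩
      refine ⟨(esymmPoly K (insert k s)).coeff r, ⟨Submodule.subset_span ⟨r, rfl⟩,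
        coeff_esymmPoly_mem_esymmSolutions _ r⟩, ?_⟩
      rw [diffOp_coeff_esymmPoly (Finset.mem_insert_self k s), Finset.erase_insert hk]
    obtain ⟨g, ⟨hg1, hg2⟩, hg3⟩ := h2 (ih h1)
    have h3 : diffOp k (f - g) = 0 := by rw [map_sub, hg3, sub_self]
    obtain ⟨h4, -, h5⟩ := (esymmSolutions K (insert k s)).sub_mem hf hg2
    obtain ⟨c, hc⟩ := eq_algebraMap_of_diffOp (f := f - g) fun l => by
      by_cases hl : l ∈ insert k s
      · have h6 := h5 k (Finset.mem_insert_self k s) l hl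
        rw [h3, map_zero, mul_zero, sub_zero] at h6
        exact h6.symm
      · exact h4 l hl
    rw [← sub_add_cancel f g, hc, Algebra.algebraMap_eq_smul_one,
      ← coeff_esymmPoly_card (insert k s)]
    exact Submodule.add_mem _ (Submodule.smul_mem _ _ (Submodule.subset_span ⟨_, rfl⟩)) hg1

theorem exists_eq_smul_H₁ {f : Ubar K n} (hn : 1 ≤ n) (h1 : ∀ k, diffOp k (diffOp k f) = 0)
    (h2 : ∀ k l : Fin n, diffOp l f = diffOp k f) :
    ∃ a b : K, f = a • H₁ K n + algebraMap K _ b := by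
  let o : Fin n := ⟨0, hn⟩
  obtain ⟨a, ha⟩ := eq_algebraMap_of_diffOp (f := diffOp o f) fun k => by
    rw [h2 k o, h1]
  obtain ⟨b, hb⟩ := eq_algebraMap_of_diffOp (f := f - a • H₁ K n) fun k => by
    rw [map_sub, h2 o k, ha, map_smul, diffOp_apply, H₁, map_sum, ← Finset.sum_sub_distrib]
    simp [Pi.single_apply, Algebra.algebraMap_eq_smul_one]
  exact ⟨a, b, by rw [← hb]; ring⟩

end DifferenceEquations

/-! ### Sufficiency: reordering and centrality -/

section CentralElements

section Ring

variable {R : Type*} [Ring R] {ι : Type*} [Fintype ι] [DecidableEq ι]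

theorem neg_one_mul_cancel (a b y : R) : a + -1 * y - (b - y) = a - b := by
  noncomm_ring

theorem one_mul_cancel (a b y : R) : a - (b - y) = a + 1 * y - b := by
  noncomm_ring

theorem mul_mul_eq_of_mul_eq {a b c s t u v : R} (h1 : a * b = b * s * a + t - u)
    (h2 : c * a = v + s * (a * c)) : a * (b * c) = b * c * a - b * v + (t * c - u * c) := by
  rw [mul_assoc b c a, h2, ← mul_assoc, h1]
  noncomm_ring

/-- For a = x^{kγ}, b = ∂_{iα}, c = x^{iα} the same entry s = `rswap K i k` occurs in the cross
relation and in the exchange relation, so it can be eliminated between them. -/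
theorem mul_mul_eq_of_mul_eq' {a b c s t u v : R} (h1 : c * a = a * s * c + t - u)
    (h2 : a * b = v + b * a * s) : b * c * a = a * (b * c) - v * c + (b * t - b * u) := by
  rw [mul_assoc b c a, h1, ← mul_assoc a b c, h2]
  noncomm_ring

/-- With all coefficients equal to 1, the corrections E_i cancel against the full sum contributed by
the index k. -/
theorem mul_sum_eq_of_mul_eq {y : R} {e E : ι → R} {k : ι}
    (he : ∀ i, y * e i = e i * y - E i + if k = i then (∑ p, E p) - y else 0) :
    y * ∑ i, e i = (∑ i, e i) * y - y := by
  rw [Finset.mul_sum, Finset.sum_congr rfl fun i _ => he i, Finset.sum_add_distrib,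
    Finset.sum_sub_distrib, Finset.sum_ite_eq, if_pos (Finset.mem_univ k), Finset.sum_mul]
  abel

theorem sum_mul_eq_of_mul_eq {y : R} {e E : ι → R} {k : ι}
    (he : ∀ i, e i * y = y * e i - E i + if i = k then (∑ p, E p) - y else 0) :
    (∑ i, e i) * y = y * (∑ i, e i) - y := by
  rw [Finset.sum_mul, Finset.sum_congr rfl fun i _ => he i, Finset.sum_add_distrib,
    Finset.sum_sub_distrib, Finset.sum_ite_eq', if_pos (Finset.mem_univ k), Finset.mul_sum]
  abel

variable {U : Type*} [CommRing U]

/-- When the correction is itself a multiple c(b_i) e_i y, comparing the coefficients of y and of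
each e_i y reduces commutation to the two scalar identities `hf` and `hg`. -/
theorem mul_sub_sum_eq {y : R} {e : ι → R} {b : ι → U} {k : ι} {c : U →+* R} {σ : U →+* U}
    {f : U} {g : ι → U} (hc : ∀ u, y * c u = c (σ u) * y)
    (he : ∀ i, y * e i = e i * y - c (b i) * e i * y +
      if k = i then (∑ p, c (b p) * e p * y) - y else 0)
    (hf : f = σ f + σ (g k)) (hg : ∀ i, g i = σ (g i) * (1 - b i) + σ (g k) * b i) :
    y * (c f - ∑ i, c (g i) * e i) = (c f - ∑ i, c (g i) * e i) * y := by
  have h1 : ∀ i, y * (c (g i) * e i) = c (σ (g i) * (1 - b i)) * e i * y +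
      if k = i then (∑ p, c (σ (g k) * b p) * e p * y) - c (σ (g k)) * y else 0 := by
    intro i
    rw [← mul_assoc, hc, mul_assoc, he, mul_add]
    congr 1
    · simp only [map_mul, map_sub, map_one]
      noncomm_ring
    · split_ifs with hki
      · subst hki
        rw [mul_sub, Finset.mul_sum]
        simp only [map_mul, mul_assoc]
      · rw [mul_zero]
  rw [mul_sub, Finset.mul_sum, Finset.sum_congr rfl fun i _ => h1 i, Finset.sum_add_distrib,
    Finset.sum_ite_eq, if_pos (Finset.mem_univ k), ← add_sub_assoc, ← Finset.sum_add_distrib,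
    sub_mul, Finset.sum_mul, hc]
  have h2 : ∀ i, c (σ (g i) * (1 - b i)) * e i * y + c (σ (g k) * b i) * e i * y =
      c (g i) * e i * y := by
    intro i
    conv_rhs => rw [hg i, map_add, add_mul, add_mul]
  rw [Finset.sum_congr rfl fun i _ => h2 i]
  conv_rhs => rw [hf, map_add, add_mul]
  abel

theorem sub_sum_mul_eq {y : R} {e : ι → R} {b : ι → U} {k : ι} {c : U →+* R} {σ : U →+* U}
    {f : U} {g : ι → U} (hc : ∀ u, c u * y = y * c (σ u))
    (he : ∀ i, e i * y = y * e i - y * c (b i) * e i +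
      if i = k then (∑ p, y * c (b p) * e p) - y else 0)
    (hf : f = σ f + σ (g k)) (hg : ∀ i, g i = σ (g i) * (1 - b i) + σ (g k) * b i) :
    (c f - ∑ i, c (g i) * e i) * y = y * (c f - ∑ i, c (g i) * e i) := by
  have h1 : ∀ i, c (g i) * e i * y = y * (c (σ (g i) * (1 - b i)) * e i) +
      if i = k then (∑ p, y * (c (σ (g k) * b p) * e p)) - y * c (σ (g k)) else 0 := by
    intro i
    rw [mul_assoc, he, mul_add]
    congr 1
    · simp only [map_mul, map_sub, mul_sub, ← mul_assoc, hc, sub_mul, mul_one]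
    · split_ifs with hki
      · subst hki
        rw [mul_sub, Finset.mul_sum, hc]
        simp only [map_mul, ← mul_assoc, hc]
      · rw [mul_zero]
  rw [sub_mul, Finset.sum_mul, Finset.sum_congr rfl fun i _ => h1 i, Finset.sum_add_distrib,
    Finset.sum_ite_eq', if_pos (Finset.mem_univ k), ← add_sub_assoc, ← Finset.sum_add_distrib,
    mul_sub, Finset.mul_sum, hc]
  have h2 : ∀ i, y * (c (σ (g i) * (1 - b i)) * e i) + y * (c (σ (g k) * b i) * e i) =
      y * (c (g i) * e i) := by
    intro i
    conv_rhs => rw [hg i, map_add, add_mul, mul_add]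
  rw [Finset.sum_congr rfl fun i _ => h2 i]
  conv_rhs => rw [hf, map_add, mul_add]
  abel

end Ring

variable {K : Type*} [Field K] {n N : ℕ}

theorem x_mul_euler (i k : Fin n) (γ : Fin N) :
    x K k γ * euler K N i = euler K N i * x K k γ -
      (∑ α, d K i α * coeff K n N (rdiag K i k) * x K i γ * x K k α) +
      if k = i then (∑ p, ∑ α, d K p α * coeff K n N (rdiag K p k) * x K p γ * x K k α) - x K k γ
      else 0 := by
  have h1 : ∀ α, x K k γ * (d K i α * x K i α) = d K i α * x K i α * x K k γ -
      d K i α * coeff K n N (rdiag K i k) * x K i γ * x K k α +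
      if k = i then (∑ p, d K p α * coeff K n N (rdiag K p k) * x K p γ * x K k α) -
        (if γ = α then x K k α else 0) else 0 := by
    intro α
    have h2 := mul_mul_eq_of_mul_eq (R := Diff K n N) (x_mul_d k i γ α) (x_mul_x i k α γ)
    rw [h2, ← mul_assoc (d K i α), ← mul_assoc (d K i α * _)]
    congr 1
    by_cases hki : k = i
    · subst hki
      simp only [if_true, true_and, Finset.sum_mul, ite_mul, one_mul, zero_mul]
    · simp only [hki, if_false, false_and, zero_mul]
      exact sub_self (G := Diff K n N) 0
  rw [euler, Finset.mul_sum, Finset.sum_congr rfl fun α _ => h1 α, Finset.sum_add_distrib,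
    Finset.sum_sub_distrib, Finset.sum_mul]
  congr 1
  split_ifs with hki
  · rw [Finset.sum_sub_distrib, Finset.sum_ite_eq, if_pos (Finset.mem_univ γ), Finset.sum_comm]
  · exact Finset.sum_const_zero

theorem euler_mul_d (i k : Fin n) (γ : Fin N) :
    euler K N i * d K k γ = d K k γ * euler K N i -
      (∑ α, d K k α * d K i γ * coeff K n N (rdiag K i k) * x K i α) +
      if i = k then (∑ p, ∑ α, d K k α * d K p γ * coeff K n N (rdiag K p k) * x K p α) - d K k γ
      else 0 := by
  have h1 : ∀ α, d K i α * x K i α * d K k γ = d K k γ * (d K i α * x K i α) -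
      d K k α * d K i γ * coeff K n N (rdiag K i k) * x K i α +
      if i = k then (∑ p, d K k α * d K p γ * coeff K n N (rdiag K p k) * x K p α) -
        (if γ = α then d K k α else 0) else 0 := by
    intro α
    have h2 := mul_mul_eq_of_mul_eq' (R := Diff K n N) (x_mul_d i k α γ) (d_mul_d i k γ α)
    rw [h2]
    congr 1
    by_cases hik : i = k
    · subst hik
      simp only [if_true, true_and, Finset.mul_sum, mul_ite, mul_one, mul_zero, ← mul_assoc,
        eq_comm]
    · simp only [hik, if_false, false_and, mul_zero]
      exact sub_self (G := Diff K n N) 0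
  rw [euler, Finset.sum_mul, Finset.sum_congr rfl fun α _ => h1 α, Finset.sum_add_distrib,
    Finset.sum_sub_distrib, Finset.mul_sum]
  congr 1
  split_ifs with hki
  · rw [Finset.sum_sub_distrib, Finset.sum_ite_eq, if_pos (Finset.mem_univ γ), Finset.sum_comm]
  · exact Finset.sum_const_zero

theorem mem_quadCentral {f : Ubar K n} {g : Fin n → Ubar K n}
    (hx : ∀ k γ, x K k γ * (coeff K n N f - ∑ i, coeff K n N (g i) * euler K N i) =
      (coeff K n N f - ∑ i, coeff K n N (g i) * euler K N i) * x K k γ)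
    (hd : ∀ k γ, (coeff K n N f - ∑ i, coeff K n N (g i) * euler K N i) * d K k γ =
      d K k γ * (coeff K n N f - ∑ i, coeff K n N (g i) * euler K N i)) :
    coeff K n N f - ∑ i, coeff K n N (g i) * euler K N i ∈ quadCentral K n N := by
  have h1 : ∀ i u, coeff K n N u * euler K N i = euler K N i * coeff K n N u := by
    intro i u
    rw [euler, Finset.mul_sum, Finset.sum_mul]
    refine Finset.sum_congr rfl fun α _ => ?_
    rw [mul_assoc, x_mul_coeff, ← mul_assoc (d K i α), d_mul_coeff, shift_shift,
      ← Pi.single_add, add_neg_cancel, Pi.single_zero, shift_zero, mul_assoc]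
  refine ⟨Submodule.sub_mem _ ?_ (Submodule.sum_mem _ fun i _ => ?_),
    (Subalgebra.mem_center_iff (R := K)).mpr fun y => ?_⟩
  · exact Submodule.subset_span ⟨f, [], by simp, by simp, by simp⟩
  · rw [euler, Finset.mul_sum]
    refine Submodule.sum_mem _ fun α _ => Submodule.subset_span ⟨g i, [d K i α, x K i α], le_rfl,
      ?_, by simp⟩
    intro y hy
    rcases List.mem_pair.mp hy with rfl | rfl
    exacts [⟨i, α, Or.inr rfl⟩, ⟨i, α, Or.inl rfl⟩]
  · induction y using diff_induction with
    | hc u =>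
      rw [mul_sub, sub_mul, ← map_mul, ← map_mul, mul_comm u, Finset.mul_sum, Finset.sum_mul]
      congr 1
      refine Finset.sum_congr rfl fun i _ => ?_
      rw [← mul_assoc, ← map_mul, mul_comm u, map_mul, mul_assoc, h1, mul_assoc]
    | hx k γ => exact hx k γ
    | hd k γ => exact (hd k γ).symm
    | hadd y z hy hz => rw [add_mul, mul_add, hy, hz]
    | hmul y z hy hz => rw [mul_assoc, hz, ← mul_assoc, hy, mul_assoc]

theorem sub_sum_euler_mem_quadCentral :
    coeff K n N (H₁ K n) - ∑ i, coeff K n N 1 * euler K N i ∈ quadCentral K n N := by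
  have h1 : ∀ k (c : ℤ), shift (Pi.single k c) (H₁ K n) = H₁ K n + (c : Ubar K n) := by
    intro k c
    simp only [H₁, map_sum, shift_h, Finset.sum_add_distrib]
    congr 1
    rw [Finset.sum_eq_single k] <;> simp +contextual
  apply mem_quadCentral
  · intro k γ
    simp only [map_one, one_mul]
    rw [mul_sub, sub_mul, mul_sum_eq_of_mul_eq fun i => x_mul_euler i k γ, x_mul_coeff, h1]
    simp only [map_add, Int.cast_neg, Int.cast_one, map_neg, map_one, add_mul]
    exact neg_one_mul_cancel (R := Diff K n N) _ _ _
  · intro k γ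
    simp only [map_one, one_mul]
    rw [mul_sub, sub_mul, sum_mul_eq_of_mul_eq fun i => euler_mul_d i k γ, d_mul_coeff, h1]
    simp only [map_add, Int.cast_one, map_one, add_mul]
    exact one_mul_cancel (R := Diff K n N) _ _ _

/-- Shifting h_k by +1 turns this into Δ_k Δ_i f = r (Δ_k f - Δ_i f) with r = `rdiag K i k`, the
mixed equation solved for the second difference; r is unchanged when h_i and h_k are shifted
together. -/
theorem shift_neg_one_of_mem_esymmSolutions {f : Ubar K n} (hf : f ∈ esymmSolutions K Finset.univ)
    (i k : Fin n) : diffOp i f = shift (Pi.single k (-1)) (diffOp i f) *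
      (1 - shift (Pi.single i 1) (rdiag K i k)) +
      shift (Pi.single k (-1)) (diffOp k f) * shift (Pi.single i 1) (rdiag K i k) := by
  obtain ⟨-, h2, h3⟩ := hf
  apply shift_injective (Pi.single k 1)
  have h4 : ∀ u : Ubar K n, shift (Pi.single k 1) (shift (Pi.single k (-1)) u) = u := by
    intro u
    rw [shift_shift, ← Pi.single_add, add_neg_cancel, Pi.single_zero, shift_zero]
  rw [map_add, map_mul, map_mul, map_sub, map_one, h4, h4]
  have h5 : shift (Pi.single k 1) (diffOp i f) = diffOp i f + diffOp k (diffOp i f) := by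
    rw [diffOp_apply k]
    ring
  rw [h5]
  by_cases hik : i = k
  · subst hik
    rw [h2]
    ring
  have h6 : shift (Pi.single k 1) (shift (Pi.single i 1) (rdiag K i k)) = rdiag K i k := by
    have h7 := congrArg (shift (Pi.single k 1))
      (congrArg (shift (Pi.single i 1)) (sub_mul_rdiag (K := K) hik))
    simp only [map_mul, map_sub, shift_h, map_add, map_one, map_intCast] at h7
    simp [hik, Ne.symm hik] at h7
    have h8 := sub_mul_rdiag (K := K) hik
    rw [shift_shift]
    generalize shift (Pi.single k 1 + Pi.single i 1) (rdiag K i k) = r at *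
    linear_combination (-r) * h8 + rdiag K i k * h7
  rw [h6]
  have h8 := sub_mul_rdiag (K := K) hik
  have h9 := h3 i (Finset.mem_univ i) k (Finset.mem_univ k)
  linear_combination rdiag K i k * h9 - diffOp k (diffOp i f) * h8

theorem mem_quadCentral_of_mem_esymmSolutions {f : Ubar K n}
    (hf : f ∈ esymmSolutions K Finset.univ) :
    coeff K n 1 f - ∑ i, coeff K n 1 (diffOp i f) * euler K 1 i ∈ quadCentral K n 1 := by
  have h1 : ∀ k : Fin n, f = shift (Pi.single k (-1)) f + shift (Pi.single k (-1)) (diffOp k f) := by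
    intro k
    rw [diffOp_apply, map_sub, shift_shift, ← Pi.single_add, neg_add_cancel, Pi.single_zero,
      shift_zero]
    ring
  apply mem_quadCentral
  · intro k γ
    refine mul_sub_sum_eq (c := (coeff K n 1).toRingHom)
      (σ := (shift (K := K) (Pi.single k (-1))).toRingHom)
      (b := fun i => shift (Pi.single i 1) (rdiag K i k)) (k := k) (fun u => x_mul_coeff k γ u) ?_
      (h1 k) (fun i => shift_neg_one_of_mem_esymmSolutions hf i k)
    intro i
    have h2 := x_mul_euler (K := K) i k γ
    -- With a single copy, γ = α, so the correction is a coefficient times E_i x^{kγ}. This is the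
    -- point where N = 1 is needed.
    have h3 : ∀ i, coeff K n 1 (shift (Pi.single i 1) (rdiag K i k)) * euler K 1 i * x K k γ =
        ∑ α, d K i α * coeff K n 1 (rdiag K i k) * x K i γ * x K k α := by
      intro i
      simp only [Subsingleton.elim γ 0, euler, Finset.univ_unique, Fin.default_eq_zero,
        Finset.sum_singleton, d_mul_coeff, mul_assoc]
    simp only [← h3] at h2
    exact h2
  · intro k γ
    refine sub_sum_mul_eq (c := (coeff K n 1).toRingHom)
      (σ := (shift (K := K) (Pi.single k (-1))).toRingHom)
      (b := fun i => shift (Pi.single i 1) (rdiag K i k)) (k := k) (fun u => ?_) ?_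
      (h1 k) (fun i => shift_neg_one_of_mem_esymmSolutions hf i k)
    · have h2 := d_mul_coeff (N := 1) k γ (shift (Pi.single k (-1)) u)
      rw [shift_shift, ← Pi.single_add, add_neg_cancel, Pi.single_zero, shift_zero] at h2
      exact h2.symm
    intro i
    have h2 := euler_mul_d (K := K) i k γ
    have h3 : ∀ i, d K k γ * coeff K n 1 (shift (Pi.single i 1) (rdiag K i k)) * euler K 1 i =
        ∑ α, d K k α * d K i γ * coeff K n 1 (rdiag K i k) * x K i α := by
      intro i
      simp only [Subsingleton.elim γ 0, euler, Finset.univ_unique, Fin.default_eq_zero,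
        Finset.sum_singleton, mul_assoc]
      rw [← mul_assoc (d K i 0), d_mul_coeff, mul_assoc]
    simp only [← h3] at h2
    exact h2

end CentralElements

/-! ### Independence and dimension counts -/

section Dimension

variable {K : Type*} [Field K] {n N : ℕ}

/-- Applying Δ_k for the inserted k turns a relation into one for the smaller set and loses only the
top coefficient, which equals 1 and is handled last. -/
theorem coeff_esymmPoly_linearIndependent [CharZero K] (s : Finset (Fin n)) (g : ℕ → K)
    (hg : ∑ r ∈ Finset.range (s.card + 1), g r • (esymmPoly K s).coeff r = 0) :
    ∀ r ≤ s.card, g r = 0 := by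
  induction s using Finset.induction_on with
  | empty =>
    intro r hr
    obtain rfl : r = 0 := by simpa using hr
    simpa [esymmPoly] using hg
  | insert k s hk ih =>
    rw [Finset.card_insert_of_notMem hk] at hg ⊢
    have h1 := congrArg (diffOp k) hg
    simp only [map_sum, map_smul, diffOp_coeff_esymmPoly (Finset.mem_insert_self k s),
      Finset.erase_insert hk, map_zero] at h1
    rw [Finset.sum_range_succ, coeff_esymmPoly_of_card_lt (Nat.lt_succ_self _), smul_zero,
      add_zero] at h1
    have h2 := ih h1
    rw [Finset.sum_range_succ, Finset.sum_eq_zero fun r hr => by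
      rw [h2 r (Nat.lt_succ_iff.mp (Finset.mem_range.mp hr)), zero_smul], zero_add,
      ← Finset.card_insert_of_notMem hk, coeff_esymmPoly_card,
      Finset.card_insert_of_notMem hk] at hg
    have h3 : g (s.card + 1) = 0 := by
      rw [← Algebra.algebraMap_eq_smul_one] at hg
      exact (algebraMap K (Ubar K n)).injective (hg.trans (map_zero _).symm)
    intro r hr
    rcases Nat.le_or_eq_of_le_succ hr with hr | rfl
    exacts [h2 r hr, h3]

variable (K n N) in
/-- The linear map sending a solution of the difference equations to the corresponding quadratic
central element. -/
def centralMap : Ubar K n →ₗ[K] Diff K n N :=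
  (coeff K n N).toLinearMap -
    ∑ i, (LinearMap.mulRight K (euler K N i)).comp ((coeff K n N).toLinearMap.comp (diffOp i))

theorem centralMap_apply (f : Ubar K n) :
    centralMap K n N f = coeff K n N f - ∑ i, coeff K n N (diffOp i f) * euler K N i := by
  rw [centralMap, LinearMap.sub_apply, LinearMap.sum_apply]
  rfl

theorem centralMap_algebraMap (c : K) :
    centralMap K n N (algebraMap K _ c) = algebraMap K _ c := by
  have h1 : ∀ i : Fin n, diffOp i (algebraMap K (Ubar K n) c) = 0 := by
    intro i
    rw [diffOp_apply, AlgHom.commutes, sub_self]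
  rw [centralMap_apply, AlgHom.commutes,
    Finset.sum_eq_zero fun i _ => by rw [h1, map_zero, zero_mul]]
  exact sub_zero (G := Diff K n N) _

theorem centralMap_H₁ :
    centralMap K n N (H₁ K n) = coeff K n N (H₁ K n) - ∑ i, coeff K n N 1 * euler K N i := by
  rw [centralMap_apply]
  congr 1
  refine Finset.sum_congr rfl fun i _ => ?_
  congr 2
  rw [diffOp_apply, H₁, map_sum, ← Finset.sum_sub_distrib]
  simp [Pi.single_apply]

theorem sum_A_eq_sum_euler : ∑ α : Fin N, A K n α α = ∑ i, euler K N i := Finset.sum_comm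

theorem sum_A_sub_H₁ :
    (∑ α : Fin N, A K n α α) - coeff K n N (H₁ K n) = -centralMap K n N (H₁ K n) := by
  rw [centralMap_H₁, sum_A_eq_sum_euler]
  simp only [map_one, one_mul]
  exact (neg_sub (α := Diff K n N) _ _).symm

variable [CharZero K]

/-- All E_i kill the vacuum, so f can be recovered from its central element; this makes `centralMap`
injective. -/
theorem fockRep_centralMap_one (f : Ubar K n) :
    fockRep (centralMap K n N f) (1 : Fock K n N) = algebraMap (Ubar K n) (Fr K n) f • 1 := by
  rw [centralMap_apply, map_sub, map_sum, LinearMap.sub_apply, LinearMap.sum_apply,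
    Finset.sum_eq_zero, sub_zero, fockRep_coeff]
  intro i _
  simp [euler, LinearMap.sum_apply, fockX_one]

theorem mkQ_centralMap_eq_zero {f : Ubar K n} :
    (Submodule.span K {(1 : Diff K n N)}).mkQ (centralMap K n N f) = 0 ↔
      ∃ c : K, f = algebraMap K _ c := by
  rw [Submodule.mkQ_apply, Submodule.Quotient.mk_eq_zero, Submodule.mem_span_singleton]
  constructor
  · rintro ⟨c, hc⟩
    refine ⟨c, ?_⟩
    have h1 := congrArg (fun t => fockRep t (1 : Fock K n N)) hc
    rw [← Algebra.algebraMap_eq_smul_one, ← centralMap_algebraMap] at h1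
    simp only [fockRep_centralMap_one] at h1
    exact (IsFractionRing.injective (Ubar K n) (Fr K n) (smul_one_injective h1)).symm
  · rintro ⟨c, rfl⟩
    exact ⟨c, by rw [centralMap_algebraMap, Algebra.algebraMap_eq_smul_one]⟩

theorem mem_quadCentral_iff (hn : 1 ≤ n) (hN : 1 < N) {z : Diff K n N} :
    z ∈ quadCentral K n N ↔ ∃ a b : K, z = centralMap K n N (a • H₁ K n + algebraMap K _ b) := by
  constructor
  · intro hz
    obtain ⟨f, hf⟩ := quadCentral_eq hz
    rw [hf] at hz
    obtain ⟨a, b, rfl⟩ := exists_eq_smul_H₁ hn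
      (fun k => diffOp_diffOp_self (by omega) hz k) (fun k l => diffOp_eq_diffOp hN hz k l)
    exact ⟨a, b, by rw [hf, centralMap_apply]⟩
  · rintro ⟨a, b, rfl⟩
    rw [map_add, map_smul, centralMap_H₁, centralMap_algebraMap]
    refine Submodule.add_mem _ (Submodule.smul_mem _ _ sub_sum_euler_mem_quadCentral)
      ⟨?_, Subalgebra.algebraMap_mem _ b⟩
    rw [← AlgHom.commutes (coeff K n N)]
    exact Submodule.subset_span ⟨algebraMap K _ b, [], by simp, by simp, by simp⟩

theorem quadCentral_one : quadCentral K n 1 = (esymmSolutions K Finset.univ).map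
    (centralMap K n 1) := by
  apply le_antisymm
  · intro z hz
    obtain ⟨f, hf⟩ := quadCentral_eq hz
    rw [hf] at hz
    exact ⟨f, ⟨fun k hk => absurd (Finset.mem_univ k) hk,
      fun k => diffOp_diffOp_self one_pos hz k, fun k _ l _ => diffOp_diffOp one_pos hz k l⟩,
      by rw [hf, centralMap_apply]⟩
  · rintro _ ⟨f, hf, rfl⟩
    rw [centralMap_apply]
    exact mem_quadCentral_of_mem_esymmSolutions hf

theorem H₁_ne_algebraMap (hn : 1 ≤ n) (c : K) : H₁ K n ≠ algebraMap K _ c := by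
  intro h1
  have h2 := congrArg (diffOp (⟨0, hn⟩ : Fin n)) h1
  rw [diffOp_apply, diffOp_apply, AlgHom.commutes, sub_self, H₁, map_sum,
    ← Finset.sum_sub_distrib] at h2
  simp [Pi.single_apply] at h2

theorem finrank_quadCentralModScalars (hn : 1 ≤ n) (hN : 1 < N) :
    Module.finrank K (quadCentralModScalars K n N) = 1 := by
  have h1 : quadCentralModScalars K n N = Submodule.span K
      {(Submodule.span K {(1 : Diff K n N)}).mkQ (centralMap K n N (H₁ K n))} := by
    ext q
    rw [quadCentralModScalars, Submodule.mem_map, Submodule.mem_span_singleton]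
    constructor
    · rintro ⟨z, hz, rfl⟩
      obtain ⟨a, b, rfl⟩ := (mem_quadCentral_iff hn hN).mp hz
      refine ⟨a, ?_⟩
      rw [map_add, map_add, mkQ_centralMap_eq_zero.mpr ⟨b, rfl⟩, add_zero, map_smul, map_smul]
    · rintro ⟨a, rfl⟩
      refine ⟨_, (mem_quadCentral_iff hn hN).mpr ⟨a, 0, rfl⟩, ?_⟩
      rw [map_zero, add_zero, map_smul, map_smul]
  rw [h1]
  refine finrank_span_singleton fun h2 => ?_
  obtain ⟨c, hc⟩ := mkQ_centralMap_eq_zero.mp h2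
  exact H₁_ne_algebraMap hn c hc

theorem finrank_quadCentralModScalars_one :
    Module.finrank K (quadCentralModScalars K n 1) = n := by
  let e : Fin n → Diff K n 1 ⧸ Submodule.span K {(1 : Diff K n 1)} := fun r =>
    (Submodule.span K {(1 : Diff K n 1)}).mkQ
      (centralMap K n 1 ((esymmPoly K Finset.univ).coeff r))
  have h1 : quadCentralModScalars K n 1 = Submodule.span K (Set.range e) := by
    rw [quadCentralModScalars, quadCentral_one, ← Submodule.map_comp]
    apply le_antisymm
    · refine (Submodule.map_mono (esymmSolutions_le _)).trans ?_
      rw [Submodule.map_span, Submodule.span_le]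
      rintro _ ⟨_, ⟨r, rfl⟩, rfl⟩
      rw [SetLike.mem_coe, LinearMap.comp_apply]
      by_cases hr : r < n
      · exact Submodule.subset_span ⟨⟨r, hr⟩, rfl⟩
      · rw [mkQ_centralMap_eq_zero.mpr]
        · exact Submodule.zero_mem _
        -- The coefficient of index n is the constant 1, and those of higher index are 0, so all of
        -- them vanish modulo scalars.
        · rcases (not_lt.mp hr).eq_or_lt with rfl | hr
          · refine ⟨1, ?_⟩
            rw [map_one]
            simpa using coeff_esymmPoly_card (K := K) (Finset.univ : Finset (Fin n))
          · exact ⟨0, (coeff_esymmPoly_of_card_lt (by simpa using hr)).trans (map_zero _).symm⟩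
    · rw [Submodule.span_le]
      rintro _ ⟨r, rfl⟩
      exact ⟨_, coeff_esymmPoly_mem_esymmSolutions _ r, rfl⟩
  have h2 : LinearIndependent K e := by
    rw [Fintype.linearIndependent_iff]
    intro g hg r
    simp only [e, ← map_smul, ← map_sum] at hg
    obtain ⟨c, hc⟩ := mkQ_centralMap_eq_zero.mp hg
    have h3 := coeff_esymmPoly_linearIndependent (Finset.univ : Finset (Fin n))
      -- The combination of e_r equals the scalar c, and 1 is the coefficient of index n; assigning
      -- -c to that index gives a genuine linear relation.
      (fun m => if hm : m < n then g ⟨m, hm⟩ else -c) (by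
        have h4 := coeff_esymmPoly_card (K := K) (Finset.univ : Finset (Fin n))
        rw [Finset.card_univ, Fintype.card_fin] at h4
        rw [Finset.card_univ, Fintype.card_fin, Finset.sum_range_succ, Finset.sum_range, h4,
          dif_neg (lt_irrefl n), neg_smul (M := Ubar K n),
          ← Algebra.algebraMap_eq_smul_one, ← hc, ← sub_eq_add_neg, sub_eq_zero]
        exact Finset.sum_congr rfl fun i _ => by rw [dif_pos i.2])
    have h5 := h3 r (by simp [r.2.le])
    rwa [dif_pos r.2] at h5
  rw [h1, finrank_span_eq_card h2, Fintype.card_fin]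

end Dimension

end HDiff

end

theorem mainTheorem11 (K : Type*) [Field K] [CharZero K] (n : ℕ) (hn : 1 ≤ n) :
    (∀ N : ℕ, 1 < N →
      (∀ z : HDiff.Diff K n N,
        z ∈ HDiff.quadCentral K n N ↔
          ∃ a b : K, z =
            a • ((∑ α : Fin N, HDiff.A K n α α) - HDiff.coeff K n N (HDiff.H₁ K n))
              + algebraMap K (HDiff.Diff K n N) b) ∧
      Module.finrank K (HDiff.quadCentralModScalars K n N) = 1) ∧
    Module.finrank K (HDiff.quadCentralModScalars K n 1) = n := by
  refine ⟨fun N hN => ⟨fun z => ?_, HDiff.finrank_quadCentralModScalars hn hN⟩,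
    HDiff.finrank_quadCentralModScalars_one⟩
  rw [HDiff.mem_quadCentral_iff hn hN, HDiff.sum_A_sub_H₁]
  simp only [map_add, map_smul, HDiff.centralMap_algebraMap]
  constructor
  · rintro ⟨a, b, rfl⟩
    exact ⟨-a, b, congrArg (· + _) (neg_smul_neg (M := HDiff.Diff K n N) _ _).symm⟩
  · rintro ⟨a, b, rfl⟩
    refine ⟨-a, b, congrArg (· + _) ?_⟩
    exact (smul_neg (A := HDiff.Diff K n N) _ _).trans (neg_smul (M := HDiff.Diff K n N) _ _).symm
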